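/- **Setting.** Let $\mathcal X$ be a measurable space, $\mathcal A$ a finite set, $H,N\ge 1$ integers, and let an MDP be given by an initial distribution $d_1$ on $\mathcal X$, transition kernels $P_h$ from $\mathcal X\times\mathcal A$ to $\mathcal X$ and conditional cost distributions $C_h(x,a)$ on $[0,1]$, $h\in[H]=\{1,\dots,H\}$. A policy $\pi=(\pi_1,\dots,\pi_H)$ consists of kernels $\pi_h$ from $\mathcal X$ to $\mathcal A$. Rolling in $\pi$ means: $x_1\sim d_1$ and, for $h=1,\dots,H$, $a_h\sim\pi_h(x_h)$ and, independently given $(x_h,a_h)$, $c_h\sim C_h(x_h,a_h)$ and $x_{h+1}\sim P_h(x_h,a_h)$. Let $d_h^\pi$ be the law of $(x_h,a_h)$, $Z^\pi=\sum_{h=1}^H c_h$ the return and $V^\pi=\mathbb E[Z^\pi]$. Given probability distributions $\nu_1,\dots,\nu_H$ on $\mathcal X\times\mathcal A$, put $C^\pi=\max_h\|\mathrm d d_h^\pi/\mathrm d\nu_h\|_\infty$, with $C^\pi=\infty$ if $d^\pi_h\not\ll\nu_h$ for some $h$. Fix a measure $\lambda$ on $\mathbb R$. Let $\Pi$ be a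 finite non-empty set of policies and $\mathcal F=\mathcal F_1\times\dots\times\mathcal F_H$, where each $\mathcal F_h$ is a finite set of conditional distributions $f(\cdot\mid x,a)$ on $[0,1]$ with densities with respect to $\lambda$; let $\mathcal F_{H+1}$ consist of the point mass at $0$ alone. For a conditional distribution $d$, let $\mathcal T_h^{\pi,D}d(x,a)$ be the law of $c+y$, where $c\sim C_h(x,a)$, $x'\sim P_h(x,a)$ are independent, $a'\sim\pi_{h+1}(x')$ and $y\sim d(x',a')$ (for $h=H$: $y=0$). Bellman completeness means: for all $\pi\in\Pi$, $h\in[H]$ and $f_{h+1}\in\mathcal F_{h+1}$ we have $\mathcal T_h^{\pi,D}f_{h+1}\in\mathcal F_h$. (Then returns of policies in $\Pi$ lie in $[0,1]$ almost surely.) **P-DISCO.** The data are, for each $h\in[H]$, $N$ i.i.d. samples $(x_{h,i},a_{h,i},c_{h,i},x'_{h,i})$ with $(x_{h,i},a_{h,i})\sim\nu_h$ and, independently given these, $c_{h,i}\sim C_h(x_{h,i},a_{h,i})$ and $x'_{h,i}\sim P_h(x_{h,i},a_{h,i})$. For $\pi\in\Pi$, $f\in\mathcal F$, $h\in[H]$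 and $i\in[N]$ the learner draws $a'\sim\pi_{h+1}(x'_{h,i})$, $y\sim f_{h+1}(x'_{h,i},a')$ (with $y=0$ if $h=H$), independently over $i$, and sets $z^{\pi,f}_{h,i}=c_{h,i}+y$. For a threshold $\beta$ let $$\mathcal F_\pi=\Big\{f\in\mathcal F:\ \forall h\in[H],\ \sum_{i=1}^N\log f_h(z^{\pi,f}_{h,i}\mid x_{h,i},a_{h,i})\ \ge\ \max_{g\in\mathcal F_h}\sum_{i=1}^N\log g(z^{\pi,f}_{h,i}\mid x_{h,i},a_{h,i})-\beta\Big\},$$ with $\log 0=-\infty$. Writing $\bar f_1(x,\pi)=\mathbb E_{a\sim\pi_1(x)}$ of the mean of $f_1(\cdot\mid x,a)$, let $f^\pi\in\arg\max_{f\in\mathcal F_\pi}\mathbb E_{x_1\sim d_1}[\bar f_1(x_1,\pi)]$ for each $\pi\in\Pi$. P-DISCO returns $\hat\pi\in\arg\min_{\pi\in\Pi}\mathbb E_{x_1\sim d_1}[\bar f^\pi_1(x_1,\pi)]$, with ties broken arbitrarily. **Theorem (second-order bounds for offline RL).** There is a universal constant $K>0$ such that the following holds in every setting as above that satisfies Bellman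 completeness. Let $\delta\in(0,1)$ and $\beta=\log(H|\Pi||\mathcal F|/\delta)$. Then with probability at least $1-\delta$, all the sets $\mathcal F_\pi$, $\pi\in\Pi$, are non-empty, so that P-DISCO with threshold $\beta$ returns a policy, and every policy $\hat\pi$ it may return satisfies, for every $\tilde\pi\in\Pi$ with $C^{\tilde\pi}<\infty$, $$V^{\hat\pi}-V^{\tilde\pi}\ \le\ K\left(H\sqrt{\frac{\operatorname{Var}(Z^{\tilde\pi})\,C^{\tilde\pi}\,\beta}{N}}+\frac{H^{2.5}\,C^{\tilde\pi}\,\beta}{N}\right).$$ -/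

import Mathlib

open MeasureTheory ProbabilityTheory
open scoped ENNReal NNReal

namespace OfflineDistRL

/-- A conditional distribution on `[0,1]` given a state and an action, with a density with respect
to the dominating measure `ρ`. The density is a fixed, jointly measurable version; it is what the
log-likelihood evaluates. -/
structure CondDist (X A : Type*) [MeasurableSpace X] [MeasurableSpace A] (ρ : Measure ℝ) where
  kernel : Kernel (X × A) ℝ
  density : X × A → ℝ → ℝ≥0
  isMarkov : IsMarkovKernel kernel
  measurable_density : Measurable (Function.uncurry density)
  kernel_eq : ∀ p, kernel p = ρ.withDensity (fun y => (density p y : ℝ≥0∞))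
  mem_unit : ∀ p, ∀ᵐ y ∂(kernel p), y ∈ Set.Icc (0 : ℝ) 1

/-- A (possibly randomized, possibly time-dependent) Markov policy with horizon `H`. -/
structure Policy (H : ℕ) (X A : Type*) [MeasurableSpace X] [MeasurableSpace A] where
  act : Fin H → Kernel X A
  isMarkov : ∀ h, IsMarkovKernel (act h)

/-- A finite-horizon Markov decision process; step `h : Fin H` stands for step `h + 1` of
`1, …, H`. The initial state is drawn from `init`. -/
structure MDP (H : ℕ) (X A : Type*) [MeasurableSpace X] [MeasurableSpace A] where
  init : Measure X
  trans : Fin H → Kernel (X × A) X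
  cost : Fin H → Kernel (X × A) ℝ
  init_isProbability : IsProbabilityMeasure init
  trans_isMarkov : ∀ h, IsMarkovKernel (trans h)
  cost_isMarkov : ∀ h, IsMarkovKernel (cost h)
  cost_mem_unit : ∀ h p, ∀ᵐ c ∂(cost h p), c ∈ Set.Icc (0 : ℝ) 1

noncomputable section

variable {H N : ℕ} {X A : Type*} [MeasurableSpace X] [MeasurableSpace A] {ρ : Measure ℝ}

/-- The joint law of `(x_{n+1}, c_1 + ⋯ + c_n)` when rolling in `π` from `x_1 ∼ init`: in each
step `a ∼ π_h(x)`, then independently `c ∼ C_h(x,a)` and `x' ∼ P_h(x,a)`, and `(x, s)` becomes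
`(x', s + c)`. -/
def rollIn (M : MDP H X A) (π : Policy H X A) : ℕ → Measure (X × ℝ)
  | 0 => M.init.prod (Measure.dirac 0)
  | n + 1 =>
    if hn : n < H then
      ((rollIn M π n ⊗ₘ (π.act ⟨n, hn⟩).comap Prod.fst measurable_fst) ⊗ₘ
        (M.cost ⟨n, hn⟩ ×ₖ M.trans ⟨n, hn⟩).comap
          (fun q : (X × ℝ) × A => (q.1.1, q.2)) (by fun_prop)).map
        (fun q => (q.2.2, q.1.1.2 + q.2.1))
    else rollIn M π n

/-- The occupancy measure `d^π_h`: the law of `(x_h, a_h)` under `π`. -/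
def occupancy (M : MDP H X A) (π : Policy H X A) (h : Fin H) : Measure (X × A) :=
  (rollIn M π h).map Prod.fst ⊗ₘ π.act h

/-- The law of the return `Z^π = c_1 + ⋯ + c_H`, with `x_1 ∼ init`. -/
def returnLaw (M : MDP H X A) (π : Policy H X A) : Measure ℝ :=
  (rollIn M π H).map Prod.snd

/-- The value `V^π`, the mean of the return. -/
def value (M : MDP H X A) (π : Policy H X A) : ℝ := ∫ z, z ∂(returnLaw M π)

/-- The variance of the return `Z^π`. -/
def returnVar (M : MDP H X A) (π : Policy H X A) : ℝ := Var[id; returnLaw M π]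

open Classical in
/-- Single-policy concentrability `max_h ‖d d^π_h / d ν_h‖_∞`, which is `∞` if some `d^π_h` is
not absolutely continuous with respect to `ν_h`. -/
def concentrability (M : MDP H X A) (ν : Fin H → Measure (X × A)) (π : Policy H X A) : ℝ≥0∞ :=
  ⨆ h, if occupancy M π h ≪ ν h then essSup ((occupancy M π h).rnDeriv (ν h)) (ν h) else ∞

/-- `x ↦` the law of `y` when `a ∼ π(x)` and `y ∼ d(x,a)`. -/
def follow (π : Kernel X A) (d : Kernel (X × A) ℝ) : Kernel X ℝ :=
  d ∘ₖ (Kernel.id ×ₖ π)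

/-- The cost-to-go after the last step is `0`. -/
def terminal : Kernel X ℝ := Kernel.const X (Measure.dirac 0)

/-- The distributional Bellman backup: the law of `c + y` for independent `c ∼ C_h(x,a)` and
`x' ∼ P_h(x,a)`, and `y ∼ κ(x')`. For `κ = follow π_{h+1} d` this is the distributional
Bellman operator of `π` applied to `d`. -/
def bellman (M : MDP H X A) (h : Fin H) (κ : Kernel X ℝ) : Kernel (X × A) ℝ :=
  (M.cost h ×ₖ (κ ∘ₖ M.trans h)).map (fun p => p.1 + p.2)

/-- Distributional Bellman completeness of the classes `F_1, …, F_H` for all policies in `Π`,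
where `F_{H+1}` consists of the point mass at `0`. -/
structure BellmanComplete (M : MDP H X A) (Pi : Finset (Policy H X A))
    (F : Fin H → Finset (CondDist X A ρ)) : Prop where
  step : ∀ π ∈ Pi, ∀ (h : Fin H) (hh : (h : ℕ) + 1 < H), ∀ d ∈ F ⟨h + 1, hh⟩,
    ∃ g ∈ F h, g.kernel = bellman M h (follow (π.act ⟨h + 1, hh⟩) d.kernel)
  last : ∀ h : Fin H, (h : ℕ) + 1 = H → ∃ g ∈ F h, g.kernel = bellman M h terminal

/-- The law of a sample `y` of the candidate cost-to-go `f_{h+1}` from the next state,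
with the next action taken by `π`; zero after the last step. -/
def continuation (π : Policy H X A) (f : Fin H → CondDist X A ρ) (h : Fin H) : Kernel X ℝ :=
  if hh : (h : ℕ) + 1 < H then follow (π.act ⟨h + 1, hh⟩) (f ⟨h + 1, hh⟩).kernel else terminal

/-- The realized input of the algorithm: the transitions `((x,a), c, x')` for each step and
sample index, and the learner's own draws `y` made for each `π` and `f`. -/
structure Dataset (H N : ℕ) (X A : Type*) [MeasurableSpace X] [MeasurableSpace A]
    (ρ : Measure ℝ) where
  xa : Fin H → Fin N → X × A
  c : Fin H → Fin N → ℝ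
  next : Fin H → Fin N → X
  y : Policy H X A → (Fin H → CondDist X A ρ) → Fin H → Fin N → ℝ

/-- The law of one sample `((x,a), (c, x'), y)` at step `h`: `(x,a) ∼ ν_h`, independently
`c ∼ C_h(x,a)` and `x' ∼ P_h(x,a)`, and then `y ∼ continuation π f h x'`. -/
def sampleLaw (M : MDP H X A) (ν : Fin H → Measure (X × A)) (π : Policy H X A)
    (f : Fin H → CondDist X A ρ) (h : Fin H) : Measure ((X × A) × (ℝ × X) × ℝ) :=
  ν h ⊗ₘ ((M.cost h ×ₖ M.trans h) ⊗ₖ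
    (continuation π f h).comap (fun q : (X × A) × (ℝ × X) => q.2.2) (by fun_prop))

/-- `D` is a random dataset as in offline RL: for each step `h`, and each `π` and `f` that the
algorithm considers, the `N` samples are i.i.d. No assumption is made on the joint law of the
samples of different steps, or of the draws `y` for different `π` and `f`. -/
def IsOfflineData {Ω : Type*} [MeasurableSpace Ω] (P : Measure Ω) (M : MDP H X A)
    (ν : Fin H → Measure (X × A)) (Pi : Finset (Policy H X A))
    (F : Fin H → Finset (CondDist X A ρ)) (D : Ω → Dataset H N X A ρ) : Prop :=
  ∀ π ∈ Pi, ∀ f ∈ Fintype.piFinset F, ∀ h : Fin H,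
    let s : Fin N → Ω → (X × A) × (ℝ × X) × ℝ :=
      fun i ω => ((D ω).xa h i, ((D ω).c h i, (D ω).next h i), (D ω).y π f h i)
    (∀ i, Measurable (s i)) ∧ iIndepFun s P ∧ ∀ i, P.map (s i) = sampleLaw M ν π f h

/-- The log-likelihood `∑_i log g(z_i ∣ x_{h,i}, a_{h,i})` at step `h` of a candidate `g` on the
targets `z_i = c_{h,i} + y_i` drawn for `π` and `f`. Here `log 0 = -∞`. -/
def logLik (D : Dataset H N X A ρ) (π : Policy H X A) (f : Fin H → CondDist X A ρ) (h : Fin H)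
    (g : CondDist X A ρ) : EReal :=
  ∑ i, ENNReal.log (g.density (D.xa h i) (D.c h i + D.y π f h i) : ℝ≥0∞)

/-- The maximum likelihood confidence set for `π` with threshold `β`, in `F = F_1 × ⋯ × F_H`. -/
def confSet (F : Fin H → Finset (CondDist X A ρ)) (β : ℝ) (D : Dataset H N X A ρ)
    (π : Policy H X A) : Set (Fin H → CondDist X A ρ) :=
  {f | f ∈ Fintype.piFinset F ∧
    ∀ h, (⨆ g ∈ F h, logLik D π f h g) - (β : EReal) ≤ logLik D π f h (f h)}

/-- The estimate `E_{x ∼ init} E_{a ∼ π_1(x)} [mean of f_1(x,a)]` of the value of `π`. -/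
def estimate [NeZero H] (M : MDP H X A) (π : Policy H X A) (f : Fin H → CondDist X A ρ) : ℝ :=
  ∫ x, ∫ a, ∫ y, y ∂((f 0).kernel (x, a)) ∂(π.act 0 x) ∂M.init

/-- `πhat` is an output of P-DISCO on `D`, under some way of breaking ties: `sel π` maximizes the
value estimate over the confidence set of `π`, and `πhat` minimizes the resulting pessimistic
estimate over `Π`. -/
def IsPDiscoOutput [NeZero H] (M : MDP H X A) (Pi : Finset (Policy H X A))
    (F : Fin H → Finset (CondDist X A ρ)) (β : ℝ) (D : Dataset H N X A ρ)
    (πhat : Policy H X A) : Prop :=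
  ∃ sel : Policy H X A → Fin H → CondDist X A ρ,
    (∀ π ∈ Pi, sel π ∈ confSet F β D π ∧
      ∀ f ∈ confSet F β D π, estimate M π f ≤ estimate M π (sel π)) ∧
    πhat ∈ Pi ∧ ∀ π ∈ Pi, estimate M πhat (sel πhat) ≤ estimate M π (sel π)

end

end OfflineDistRL

/-!
By Bellman completeness, the Bellman backup `g` of a candidate `f_{h+1}` lies in `F_h` and is the
true conditional law of the regression targets that `f` generates. Likelihood ratio tests against
`g` therefore, with high probability, accept the true conditional return laws, by Markov's
inequality for `f / g`, and reject every `f_h` at mean squared Hellinger distance above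
`5 β / (2 N)` from `g`, by Markov's inequality for `√(f / g)`, whose mean is the Bhattacharyya
affinity.

If all squared Bellman errors are at most `ε` under the data distributions, they are at most `C ε`
along the rollout of the comparator. The Hellinger distance is a metric and contracts under Bellman
backups, so the predicted and the true return law are at squared distance at most `H² C ε`. Two laws
on `[0, 1]` at squared distance `η` have means within `4 (√(V η) + η)`, where `V` is the variance of
either one. This controls the optimistic estimate of the comparator, and since the confidence set of
the output contains its true return laws, the output costs at most that estimate.
-/

namespace OfflineDistRL

noncomputable section

section Hellinger

variable {α β : Type*} [MeasurableSpace α] [MeasurableSpace β] {μ ν : Measure α}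

/-- The Bhattacharyya affinity, equal to `∫ √(u v) dρ` for measures with densities `u` and `v` with
respect to `ρ`. It is encoded in the variational form suggested by AM-GM, which refers to no
dominating measure and makes concavity and data processing immediate. -/
def affinity (μ ν : Measure α) : ℝ≥0∞ :=
  ⨅ (φ : α → ℝ≥0∞) (_ : Measurable φ), 2⁻¹ * (∫⁻ y, φ y ∂μ + ∫⁻ y, (φ y)⁻¹ ∂ν)

/-- The squared Hellinger distance `1 - ∫ √(u v) dρ = ½ ∫ (√u - √v)² dρ` of two probability
measures with densities `u` and `v` with respect to `ρ`. -/
def hellingerSq (μ ν : Measure α) : ℝ≥0∞ := 1 - affinity μ ν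

lemma affinity_le {φ : α → ℝ≥0∞} (hφ : Measurable φ) :
    affinity μ ν ≤ 2⁻¹ * (∫⁻ y, φ y ∂μ + ∫⁻ y, (φ y)⁻¹ ∂ν) :=
  iInf₂_le φ hφ

lemma affinity_le_one [IsProbabilityMeasure μ] [IsProbabilityMeasure ν] : affinity μ ν ≤ 1 := by
  refine (affinity_le (φ := 1) measurable_const).trans_eq ?_
  simp [one_add_one_eq_two, ENNReal.inv_mul_cancel]

lemma affinity_add_hellingerSq [IsProbabilityMeasure μ] [IsProbabilityMeasure ν] :
    affinity μ ν + hellingerSq μ ν = 1 :=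
  add_tsub_cancel_of_le affinity_le_one

lemma two_mul_sqrt_mul_le (u v : ℝ≥0) (φ : ℝ≥0∞) :
    2 * (NNReal.sqrt (u * v) : ℝ≥0∞) ≤ u * φ + v * φ⁻¹ := by
  rcases eq_or_ne φ 0 with rfl | h0
  · rcases eq_or_ne v 0 with rfl | hv <;> simp [ENNReal.mul_top, *]
  rcases eq_or_ne φ ∞ with rfl | htop
  · rcases eq_or_ne u 0 with rfl | hu <;> simp [ENNReal.mul_top, *]
  lift φ to ℝ≥0 using htop
  have hφ : φ ≠ 0 := by simpa using h0
  have amgm := two_mul_le_add_sq (NNReal.sqrt (u * φ)) (NNReal.sqrt (v * φ⁻¹))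
  rw [mul_assoc, ← NNReal.sqrt_mul, mul_mul_mul_comm, mul_inv_cancel₀ hφ, mul_one,
    NNReal.sq_sqrt, NNReal.sq_sqrt] at amgm
  rw [← ENNReal.coe_inv hφ]
  exact_mod_cast amgm

lemma two_mul_sqrt_mul_eq (u v : ℝ≥0) :
    u * ((NNReal.sqrt v : ℝ≥0∞) / NNReal.sqrt u) + v * ((NNReal.sqrt v : ℝ≥0∞) / NNReal.sqrt u)⁻¹
      = 2 * (NNReal.sqrt (u * v) : ℝ≥0∞) := by
  obtain ⟨a, rfl⟩ : ∃ a, u = a ^ 2 := ⟨NNReal.sqrt u, (NNReal.sq_sqrt u).symm⟩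
  obtain ⟨b, rfl⟩ : ∃ b, v = b ^ 2 := ⟨NNReal.sqrt v, (NNReal.sq_sqrt v).symm⟩
  simp only [NNReal.sqrt_mul, NNReal.sqrt_sq]
  rcases eq_or_ne a 0 with rfl | ha
  · rcases eq_or_ne b 0 with rfl | hb <;> simp [ENNReal.div_zero, *]
  rcases eq_or_ne b 0 with rfl | hb
  · simp
  rw [← ENNReal.coe_div ha, ← ENNReal.coe_inv (div_ne_zero hb ha)]
  norm_cast
  field_simp
  ring

lemma affinity_withDensity (ρ : Measure α) {u v : α → ℝ≥0} (hu : Measurable u)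
    (hv : Measurable v) :
    affinity (ρ.withDensity fun y => u y) (ρ.withDensity fun y => v y)
      = ∫⁻ y, NNReal.sqrt (u y * v y) ∂ρ := by
  have objective {φ : α → ℝ≥0∞} (hφ : Measurable φ) :
      2⁻¹ * (∫⁻ y, φ y ∂(ρ.withDensity fun y => (u y : ℝ≥0∞))
        + ∫⁻ y, (φ y)⁻¹ ∂(ρ.withDensity fun y => (v y : ℝ≥0∞)))
        = ∫⁻ y, 2⁻¹ * (u y * φ y + v y * (φ y)⁻¹) ∂ρ := by
    rw [lintegral_withDensity_eq_lintegral_mul _ (by fun_prop) hφ,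
      lintegral_withDensity_eq_lintegral_mul _ (by fun_prop) (by fun_prop),
      ← lintegral_add_left (by fun_prop), ← lintegral_const_mul _ (by fun_prop)]
    rfl
  have half_two_mul (x : ℝ≥0∞) : 2⁻¹ * (2 * x) = x :=
    ENNReal.inv_mul_cancel_left two_ne_zero ENNReal.ofNat_ne_top
  refine le_antisymm ?_ (le_iInf₂ fun φ hφ => ?_)
  · have hm : Measurable fun y => (NNReal.sqrt (v y) : ℝ≥0∞) / NNReal.sqrt (u y) := by fun_prop
    refine (affinity_le hm).trans_eq ?_
    simp only [objective hm, two_mul_sqrt_mul_eq, half_two_mul]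
  · rw [objective hφ]
    refine lintegral_mono fun y => ?_
    rw [← half_two_mul (NNReal.sqrt (u y * v y))]
    gcongr
    exact two_mul_sqrt_mul_le _ _ _

lemma lintegral_eq_one_of_withDensity {ρ : Measure α} {u : α → ℝ≥0∞}
    (h : IsProbabilityMeasure (ρ.withDensity u)) : ∫⁻ y, u y ∂ρ = 1 := by
  simpa [withDensity_apply _ MeasurableSet.univ] using h.measure_univ

lemma half_ofReal_sqrt_sub_sq_add (u v : ℝ≥0) :
    2⁻¹ * ENNReal.ofReal ((√u - √v) ^ 2) + NNReal.sqrt (u * v) = 2⁻¹ * ((u : ℝ≥0∞) + v) := by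
  have sqrt_mul_eq : (NNReal.sqrt (u * v) : ℝ≥0∞) = 2⁻¹ * ENNReal.ofReal (2 * √u * √v) := by
    rw [mul_assoc, ENNReal.ofReal_mul zero_le_two, ENNReal.ofReal_ofNat,
      ENNReal.inv_mul_cancel_left two_ne_zero ENNReal.ofNat_ne_top, ← Real.sqrt_mul u.coe_nonneg,
      ← NNReal.coe_mul, ← Real.coe_sqrt, ENNReal.ofReal_coe_nnreal]
  rw [sqrt_mul_eq, ← mul_add, ← ENNReal.ofReal_add (by positivity) (by positivity), sub_sq,
    Real.sq_sqrt u.coe_nonneg, Real.sq_sqrt v.coe_nonneg, ← ENNReal.coe_add,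
    ← ENNReal.ofReal_coe_nnreal]
  congr 2
  push_cast
  ring

lemma hellingerSq_withDensity (ρ : Measure α) {u v : α → ℝ≥0} (hu : Measurable u)
    (hv : Measurable v) (hpu : IsProbabilityMeasure (ρ.withDensity fun y => (u y : ℝ≥0∞)))
    (hpv : IsProbabilityMeasure (ρ.withDensity fun y => (v y : ℝ≥0∞))) :
    hellingerSq (ρ.withDensity fun y => u y) (ρ.withDensity fun y => v y)
      = ∫⁻ y, 2⁻¹ * ENNReal.ofReal ((√(u y) - √(v y)) ^ 2) ∂ρ := by
  refine (ENNReal.eq_sub_of_add_eq (affinity_le_one.trans_lt ENNReal.one_lt_top).ne ?_).symm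
  rw [affinity_withDensity ρ hu hv, ← lintegral_add_left (by fun_prop)]
  simp_rw [half_ofReal_sqrt_sub_sq_add]
  rw [lintegral_const_mul _ (by fun_prop), lintegral_add_left (by fun_prop),
    lintegral_eq_one_of_withDensity hpu, lintegral_eq_one_of_withDensity hpv, one_add_one_eq_two,
    ENNReal.inv_mul_cancel two_ne_zero ENNReal.ofNat_ne_top]

lemma exists_nnreal_density [IsFiniteMeasure μ] [SigmaFinite ν] (h : μ ≪ ν) :
    ∃ u : α → ℝ≥0, Measurable u ∧ μ = ν.withDensity fun y => (u y : ℝ≥0∞) := by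
  refine ⟨fun y => (μ.rnDeriv ν y).toNNReal, by fun_prop, ?_⟩
  conv_lhs => rw [← Measure.withDensity_rnDeriv_eq μ ν h]
  refine withDensity_congr_ae ?_
  filter_upwards [Measure.rnDeriv_ne_top μ ν] with y hy
  exact (ENNReal.coe_toNNReal hy).symm

lemma hellingerSq_self [IsProbabilityMeasure μ] : hellingerSq μ μ = 0 := by
  obtain ⟨u, hu, h⟩ := exists_nnreal_density (Measure.AbsolutelyContinuous.refl μ)
  have hpu : IsProbabilityMeasure (μ.withDensity fun y => (u y : ℝ≥0∞)) := h ▸ inferInstance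
  rw [h, hellingerSq_withDensity μ hu hu hpu hpu]
  simp

lemma ofReal_sub_sq_le (a b c : ℝ) (t : ℝ≥0∞) :
    ENNReal.ofReal ((a - c) ^ 2)
      ≤ (1 + t) * ENNReal.ofReal ((a - b) ^ 2) + (1 + t⁻¹) * ENNReal.ofReal ((b - c) ^ 2) := by
  rcases eq_or_ne t 0 with rfl | h0
  · rcases eq_or_ne b c with rfl | hbc
    · simp
    · simp [ENNReal.top_mul, sub_eq_zero, hbc]
  rcases eq_or_ne t ∞ with rfl | htop
  · rcases eq_or_ne a b with rfl | hab
    · simp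
    · simp [ENNReal.top_mul, sub_eq_zero, hab]
  lift t to ℝ≥0 using htop
  have ht : 0 < t := pos_iff_ne_zero.2 (by simpa using h0)
  have remainder_nonneg : 0 ≤ (t : ℝ)⁻¹ * (t * (a - b) - (b - c)) ^ 2 := by positivity
  have expand : (a - c) ^ 2 + (t : ℝ)⁻¹ * (t * (a - b) - (b - c)) ^ 2
      = (1 + t : ℝ≥0) * (a - b) ^ 2 + (1 + t⁻¹ : ℝ≥0) * (b - c) ^ 2 := by
    push_cast
    field_simp
    ring
  rw [← ENNReal.coe_inv ht.ne', ← ENNReal.coe_one, ← ENNReal.coe_add, ← ENNReal.coe_add,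
    ← ENNReal.ofReal_coe_nnreal, ← ENNReal.ofReal_coe_nnreal, ← ENNReal.ofReal_mul (by positivity),
    ← ENNReal.ofReal_mul (by positivity), ← ENNReal.ofReal_add (by positivity) (by positivity),
    ← expand]
  exact ENNReal.ofReal_le_ofReal (le_add_of_nonneg_right remainder_nonneg)

lemma hellingerSq_triangle (μ ν κ : Measure α) [hμ : IsProbabilityMeasure μ]
    [hν : IsProbabilityMeasure ν] [hκ : IsProbabilityMeasure κ] (t : ℝ≥0∞) :
    hellingerSq μ κ ≤ (1 + t) * hellingerSq μ ν + (1 + t⁻¹) * hellingerSq ν κ := by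
  obtain ⟨ρ, hρ, hμρ, hνρ, hκρ⟩ : ∃ ρ : Measure α, IsFiniteMeasure ρ ∧ μ ≪ ρ ∧ ν ≪ ρ ∧ κ ≪ ρ :=
    ⟨μ + ν + κ, inferInstance,
      Measure.absolutelyContinuous_of_le (Measure.le_add_right (Measure.le_add_right le_rfl)),
      Measure.absolutelyContinuous_of_le (Measure.le_add_right (Measure.le_add_left le_rfl)),
      Measure.absolutelyContinuous_of_le (Measure.le_add_left le_rfl)⟩
  obtain ⟨u, hu, rfl⟩ := exists_nnreal_density hμρ
  obtain ⟨v, hv, rfl⟩ := exists_nnreal_density hνρ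
  obtain ⟨w, hw, rfl⟩ := exists_nnreal_density hκρ
  rw [hellingerSq_withDensity ρ hu hv hμ hν, hellingerSq_withDensity ρ hv hw hν hκ,
    hellingerSq_withDensity ρ hu hw hμ hκ, ← lintegral_const_mul _ (by fun_prop),
    ← lintegral_const_mul _ (by fun_prop), ← lintegral_add_left (by fun_prop)]
  refine lintegral_mono fun y => ?_
  rw [mul_left_comm, mul_left_comm (1 + t⁻¹), ← mul_add]
  gcongr
  exact ofReal_sub_sq_le _ _ _ t

lemma measurable_affinity [MeasurableSpace.CountableOrCountablyGenerated β α] (κ η : Kernel β α)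
    [IsFiniteKernel κ] [IsFiniteKernel η] : Measurable fun b => affinity (κ b) (η b) := by
  have density (ξ : Kernel β α) [IsFiniteKernel ξ] (b : β) (hξ : ξ b ≤ (κ + η) b) :
      ξ b = ((κ + η) b).withDensity fun y => ((ξ.rnDeriv (κ + η) b y).toNNReal : ℝ≥0∞) := by
    conv_lhs => rw [← Kernel.withDensity_rnDeriv_eq (Measure.absolutelyContinuous_of_le hξ),
      Kernel.withDensity_apply _ (by fun_prop)]
    refine withDensity_congr_ae ?_
    filter_upwards [Kernel.rnDeriv_ne_top ξ (κ + η)] with y hy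
    exact (ENNReal.coe_toNNReal hy).symm
  have hκ (b : β) := density κ b (Measure.le_add_right le_rfl)
  have hη (b : β) := density η b (Measure.le_add_left le_rfl)
  have affinity_eq : (fun b => affinity (κ b) (η b)) = fun b => ∫⁻ y, NNReal.sqrt
      ((κ.rnDeriv (κ + η) b y).toNNReal * (η.rnDeriv (κ + η) b y).toNNReal) ∂((κ + η) b) := by
    funext b
    conv_lhs => rw [hκ b, hη b]
    exact affinity_withDensity _ (by fun_prop) (by fun_prop)
  rw [affinity_eq]
  refine Measurable.lintegral_kernel_prod_right ?_
  fun_prop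

lemma measurable_hellingerSq [MeasurableSpace.CountableOrCountablyGenerated β α]
    (κ η : Kernel β α) [IsFiniteKernel κ] [IsFiniteKernel η] :
    Measurable fun b => hellingerSq (κ b) (η b) :=
  measurable_const.sub (measurable_affinity κ η)

lemma lintegral_affinity_le (m : Measure β) (κ η : Kernel β α) :
    ∫⁻ b, affinity (κ b) (η b) ∂m ≤ affinity (m.bind κ) (m.bind η) := by
  refine le_iInf₂ fun φ hφ => ?_
  rw [Measure.lintegral_bind κ.aemeasurable hφ.aemeasurable,
    Measure.lintegral_bind (f := fun y => (φ y)⁻¹) η.aemeasurable hφ.inv.aemeasurable,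
    ← lintegral_add_left hφ.lintegral_kernel, ← lintegral_const_mul' _ _ (by simp)]
  exact lintegral_mono fun b => affinity_le hφ

lemma hellingerSq_bind_le [MeasurableSpace.CountableOrCountablyGenerated β α] (m : Measure β)
    [IsProbabilityMeasure m] (κ η : Kernel β α) [IsFiniteKernel κ] [IsFiniteKernel η] :
    hellingerSq (m.bind κ) (m.bind η) ≤ ∫⁻ b, hellingerSq (κ b) (η b) ∂m := by
  refine le_trans ?_ (lintegral_sub_le' _ _ (measurable_affinity κ η).aemeasurable)
  rw [lintegral_const, measure_univ, mul_one]
  exact tsub_le_tsub_left (lintegral_affinity_le m κ η) 1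

lemma hellingerSq_conv_left_le [AddMonoid α] [MeasurableAdd₂ α] (m μ ν : Measure α)
    [IsProbabilityMeasure m] [SFinite μ] [SFinite ν] :
    hellingerSq (m ∗ μ) (m ∗ ν) ≤ hellingerSq μ ν := by
  refine tsub_le_tsub_left (le_iInf₂ fun φ hφ => ?_) 1
  have hφ_inv : Measurable fun y => (φ y)⁻¹ := hφ.inv
  rw [Measure.lintegral_conv hφ, Measure.lintegral_conv hφ_inv, ← lintegral_add_left (by fun_prop),
    ← lintegral_const_mul' _ _ (by simp)]
  calc affinity μ ν = ∫⁻ _, affinity μ ν ∂m := by simp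
    _ ≤ _ := lintegral_mono fun x => affinity_le (φ := fun y => φ (x + y)) (by fun_prop)

end Hellinger

section MeanComparison

variable {α : Type*} [MeasurableSpace α] {μ ν : Measure α}

lemma sq_integral_mul_le {f g : α → ℝ} (hf : MemLp f 2 μ) (hg : MemLp g 2 μ) :
    (∫ y, f y * g y ∂μ) ^ 2 ≤ (∫ y, f y ^ 2 ∂μ) * ∫ y, g y ^ 2 ∂μ := by
  rw [← ENNReal.ofReal_ofNat 2] at hf hg
  have holder := integral_mul_norm_le_Lp_mul_Lq (E := ℝ) Real.HolderConjugate.two_two hf hg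
  simp only [Real.norm_eq_abs, ← abs_mul, Real.rpow_two, sq_abs, ← Real.sqrt_eq_rpow] at holder
  calc (∫ y, f y * g y ∂μ) ^ 2 = |∫ y, f y * g y ∂μ| ^ 2 := (sq_abs _).symm
    _ ≤ (√(∫ y, f y ^ 2 ∂μ) * √(∫ y, g y ^ 2 ∂μ)) ^ 2 := by
      gcongr
      exact abs_integral_le_integral_abs.trans holder
    _ = (∫ y, f y ^ 2 ∂μ) * ∫ y, g y ^ 2 ∂μ := by
      rw [mul_pow, Real.sq_sqrt (integral_nonneg fun _ => sq_nonneg _),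
        Real.sq_sqrt (integral_nonneg fun _ => sq_nonneg _)]

lemma memLp_two_sqrt_mul {ρ : Measure α} {u : α → ℝ≥0} (hu : Measurable u) {g : α → ℝ}
    (hg : MemLp g 2 (ρ.withDensity fun y => (u y : ℝ≥0∞))) :
    MemLp (fun y => √(u y) * g y) 2 ρ := by
  have sqrt_mul_eq : (fun y => √(u y) * g y) = fun y => (√(u y))⁻¹ * (u y • g y) := by
    funext y
    rcases eq_or_ne (u y) 0 with h | h
    · simp [h]
    · have sqrt_ne_zero : √(u y : ℝ) ≠ 0 := by simpa using h
      rw [NNReal.smul_def, smul_eq_mul, eq_inv_mul_iff_mul_eq₀ sqrt_ne_zero, ← mul_assoc,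
        Real.mul_self_sqrt (u y).coe_nonneg]
  have meas : AEStronglyMeasurable (fun y => √(u y) * g y) ρ := by
    rw [sqrt_mul_eq]
    exact (Measurable.aestronglyMeasurable (by fun_prop)).mul
      ((aestronglyMeasurable_withDensity_iff hu).1 hg.1)
  rw [memLp_two_iff_integrable_sq meas]
  refine ((integrable_withDensity_iff_integrable_coe_smul hu).1 hg.integrable_sq).congr
    (.of_forall fun y => ?_)
  simp [mul_pow, Real.sq_sqrt]

lemma sq_integral_withDensity_sub_le {ρ : Measure α} {u v : α → ℝ≥0} (hu : Measurable u)
    (hv : Measurable v) [IsFiniteMeasure (ρ.withDensity fun y => (u y : ℝ≥0∞))]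
    [IsFiniteMeasure (ρ.withDensity fun y => (v y : ℝ≥0∞))] {g : α → ℝ}
    (hgu : MemLp g 2 (ρ.withDensity fun y => (u y : ℝ≥0∞)))
    (hgv : MemLp g 2 (ρ.withDensity fun y => (v y : ℝ≥0∞))) :
    (∫ y, g y ∂(ρ.withDensity fun y => (u y : ℝ≥0∞))
        - ∫ y, g y ∂(ρ.withDensity fun y => (v y : ℝ≥0∞))) ^ 2
      ≤ (∫ y, (√(u y) - √(v y)) ^ 2 ∂ρ) * (2 * (∫ y, g y ^ 2 ∂(ρ.withDensity fun y => (u y : ℝ≥0∞))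
        + ∫ y, g y ^ 2 ∂(ρ.withDensity fun y => (v y : ℝ≥0∞)))) := by
  have ug := memLp_two_sqrt_mul hu hgu
  have vg := memLp_two_sqrt_mul hv hgv
  have su := memLp_two_sqrt_mul (ρ := ρ) hu (memLp_const (1 : ℝ))
  have sv := memLp_two_sqrt_mul (ρ := ρ) hv (memLp_const (1 : ℝ))
  simp only [mul_one] at su sv
  have sq_sqrt (w : ℝ≥0) : √(w : ℝ) ^ 2 = w := Real.sq_sqrt w.coe_nonneg
  have iu := (integrable_withDensity_iff_integrable_smul hu).1 (hgu.integrable one_le_two)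
  have iv := (integrable_withDensity_iff_integrable_smul hv).1 (hgv.integrable one_le_two)
  simp only [integral_withDensity_eq_integral_smul hu, integral_withDensity_eq_integral_smul hv]
  calc (∫ y, u y • g y ∂ρ - ∫ y, v y • g y ∂ρ) ^ 2
      = (∫ y, (√(u y) - √(v y)) * (√(u y) * g y + √(v y) * g y) ∂ρ) ^ 2 := by
        rw [← integral_sub iu iv]
        congr 2 with y
        simp only [NNReal.smul_def, smul_eq_mul]
        linear_combination (-g y) * sq_sqrt (u y) + g y * sq_sqrt (v y)
    _ ≤ (∫ y, (√(u y) - √(v y)) ^ 2 ∂ρ) * ∫ y, (√(u y) * g y + √(v y) * g y) ^ 2 ∂ρ :=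
        sq_integral_mul_le (su.sub sv) (ug.add vg)
    _ ≤ (∫ y, (√(u y) - √(v y)) ^ 2 ∂ρ)
          * ∫ y, 2 * ((√(u y) * g y) ^ 2 + (√(v y) * g y) ^ 2) ∂ρ := by
        refine mul_le_mul_of_nonneg_left ?_ (integral_nonneg fun y => sq_nonneg _)
        exact integral_mono (ug.add vg).integrable_sq
          ((ug.integrable_sq.add vg.integrable_sq).const_mul 2) fun y => add_sq_le
    _ = _ := by
        rw [integral_const_mul, integral_add ug.integrable_sq vg.integrable_sq]
        simp only [mul_pow, sq_sqrt, NNReal.smul_def, smul_eq_mul]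

lemma integral_sq_sqrt_sub_sqrt {ρ : Measure α} {u v : α → ℝ≥0} (hu : Measurable u)
    (hv : Measurable v) (hpu : IsProbabilityMeasure (ρ.withDensity fun y => (u y : ℝ≥0∞)))
    (hpv : IsProbabilityMeasure (ρ.withDensity fun y => (v y : ℝ≥0∞))) :
    ∫ y, (√(u y) - √(v y)) ^ 2 ∂ρ = 2 * (hellingerSq (ρ.withDensity fun y => (u y : ℝ≥0∞))
      (ρ.withDensity fun y => (v y : ℝ≥0∞))).toReal := by
  rw [hellingerSq_withDensity ρ hu hv hpu hpv, lintegral_const_mul _ (by fun_prop),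
    integral_eq_lintegral_of_nonneg_ae (.of_forall fun y => sq_nonneg _)
      (Measurable.aestronglyMeasurable (by fun_prop))]
  simp

lemma sq_integral_sub_le [hμ : IsProbabilityMeasure μ] [hν : IsProbabilityMeasure ν] {g : α → ℝ}
    (hgμ : MemLp g 2 μ) (hgν : MemLp g 2 ν) :
    (∫ y, g y ∂μ - ∫ y, g y ∂ν) ^ 2
      ≤ 4 * (hellingerSq μ ν).toReal * (∫ y, g y ^ 2 ∂μ + ∫ y, g y ^ 2 ∂ν) := by
  obtain ⟨u, hu, hμu⟩ := exists_nnreal_density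
    (Measure.absolutelyContinuous_of_le (Measure.le_add_right le_rfl) : μ ≪ μ + ν)
  obtain ⟨v, hv, hνv⟩ := exists_nnreal_density
    (Measure.absolutelyContinuous_of_le (Measure.le_add_left le_rfl) : ν ≪ μ + ν)
  generalize μ + ν = ρ at hμu hνv
  subst hμu hνv
  refine (sq_integral_withDensity_sub_le hu hv hgμ hgν).trans_eq ?_
  rw [integral_sq_sqrt_sub_sqrt hu hv hμ hν]
  ring

lemma sq_integral_sub_le_of_abs_le_one [IsProbabilityMeasure μ] [IsProbabilityMeasure ν]
    {g : α → ℝ} (hmμ : AEStronglyMeasurable g μ) (hmν : AEStronglyMeasurable g ν)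
    (hμ : ∀ᵐ y ∂μ, |g y| ≤ 1) (hν : ∀ᵐ y ∂ν, |g y| ≤ 1) :
    (∫ y, g y ∂μ - ∫ y, g y ∂ν) ^ 2
      ≤ 16 * (hellingerSq μ ν).toReal * (∫ y, g y ^ 2 ∂ν + (hellingerSq μ ν).toReal) := by
  set h := (hellingerSq μ ν).toReal
  have h_nonneg : 0 ≤ h := ENNReal.toReal_nonneg
  have memLp {κ : Measure α} [IsFiniteMeasure κ] (hm : AEStronglyMeasurable g κ)
      (hκ : ∀ᵐ y ∂κ, |g y| ≤ 1) (p : ℝ≥0∞) : MemLp g p κ := MemLp.of_bound hm 1 hκ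
  have memLp_sq {κ : Measure α} [IsFiniteMeasure κ] (hm : AEStronglyMeasurable g κ)
      (hκ : ∀ᵐ y ∂κ, |g y| ≤ 1) : MemLp (fun y => g y ^ 2) 2 κ :=
    MemLp.of_bound (hm.pow 2) 1 (hκ.mono fun y hy => by simpa using hy)
  have fourth_le {κ : Measure α} [IsFiniteMeasure κ] (hm : AEStronglyMeasurable g κ)
      (hκ : ∀ᵐ y ∂κ, |g y| ≤ 1) : ∫ y, (g y ^ 2) ^ 2 ∂κ ≤ ∫ y, g y ^ 2 ∂κ :=
    integral_mono_ae (memLp_sq hm hκ).integrable_sq (memLp hm hκ 2).integrable_sq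
      (hκ.mono fun y hy => pow_le_of_le_one (sq_nonneg _) ((sq_le_one_iff_abs_le_one _).2 hy)
        two_ne_zero)
  set S := ∫ y, g y ^ 2 ∂μ
  set B := ∫ y, g y ^ 2 ∂ν
  have B_nonneg : 0 ≤ B := integral_nonneg fun y => sq_nonneg _
  have first_moment : (∫ y, g y ∂μ - ∫ y, g y ∂ν) ^ 2 ≤ 4 * h * (S + B) :=
    sq_integral_sub_le (memLp hmμ hμ 2) (memLp hmν hν 2)
  have second_moment : (S - B) ^ 2 ≤ 4 * h * (S + B) := by
    refine (sq_integral_sub_le (memLp_sq hmμ hμ) (memLp_sq hmν hν)).trans ?_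
    gcongr
    exacts [fourth_le hmμ hμ, fourth_le hmν hν]
  have S_le : S + B ≤ 4 * B + 4 * h := by nlinarith
  calc (∫ y, g y ∂μ - ∫ y, g y ∂ν) ^ 2 ≤ 4 * h * (4 * B + 4 * h) := by
        exact first_moment.trans (by gcongr)
    _ = 16 * h * (B + h) := by ring

lemma abs_integral_sub_le_of_mem_unit [IsProbabilityMeasure μ] [IsProbabilityMeasure ν]
    {X : α → ℝ} (hmμ : AEStronglyMeasurable X μ) (hmν : AEStronglyMeasurable X ν)
    (hμ : ∀ᵐ y ∂μ, X y ∈ Set.Icc 0 1) (hν : ∀ᵐ y ∂ν, X y ∈ Set.Icc 0 1) :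
    |∫ y, X y ∂μ - ∫ y, X y ∂ν|
      ≤ 4 * (√(Var[X; ν] * (hellingerSq μ ν).toReal) + (hellingerSq μ ν).toReal) := by
  set h := (hellingerSq μ ν).toReal
  have h_nonneg : 0 ≤ h := ENNReal.toReal_nonneg
  have Xμ : Integrable X μ := .of_mem_Icc 0 1 hmμ.aemeasurable hμ
  have Xν : Integrable X ν := .of_mem_Icc 0 1 hmν.aemeasurable hν
  set m := ∫ y, X y ∂ν with hm
  have m_mem : m ∈ Set.Icc (0 : ℝ) 1 :=
    ⟨integral_nonneg_of_ae (hν.mono fun y hy => hy.1), by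
      simpa using integral_mono_ae Xν (integrable_const 1) (hν.mono fun y hy => hy.2)⟩
  have centered {y : α} (hy : X y ∈ Set.Icc 0 1) : |X y - m| ≤ 1 :=
    abs_sub_le_iff.2 ⟨by linarith [hy.2, m_mem.1], by linarith [hy.1, m_mem.2]⟩
  have key := sq_integral_sub_le_of_abs_le_one (g := fun y => X y - m)
    (hmμ.sub aestronglyMeasurable_const) (hmν.sub aestronglyMeasurable_const)
    (hμ.mono fun y hy => centered hy) (hν.mono fun y hy => centered hy)
  rw [integral_sub Xμ (integrable_const m), integral_sub Xν (integrable_const m), ← hm,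
    ← variance_eq_integral hmν.aemeasurable] at key
  have V_nonneg := variance_nonneg X ν
  refine abs_le_of_sq_le_sq ?_ (by positivity)
  calc (∫ y, X y ∂μ - m) ^ 2 ≤ 16 * h * (Var[X; ν] + h) := by simpa using key
    _ = 4 ^ 2 * (√(Var[X; ν] * h) ^ 2 + h ^ 2) := by
      rw [Real.sq_sqrt (by positivity)]
      ring
    _ ≤ (4 * (√(Var[X; ν] * h) + h)) ^ 2 := by
      rw [mul_pow, add_sq]
      gcongr
      nlinarith [mul_nonneg (Real.sqrt_nonneg (Var[X; ν] * h)) h_nonneg]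

end MeanComparison

section LikelihoodRatio

lemma mul_sqrt_div (u v : ℝ≥0) : v * NNReal.sqrt (u / v) = NNReal.sqrt (u * v) := by
  rcases eq_or_ne v 0 with rfl | hv
  · simp
  · rw [eq_comm, NNReal.sqrt_eq_iff_eq_sq, mul_pow, NNReal.sq_sqrt]
    field_simp

lemma measure_exp_mul_prod_le_prod_le {Ω S ι : Type*} [MeasurableSpace Ω] [MeasurableSpace S]
    [Fintype ι] {P : Measure Ω} {Q : Measure S} {ξ : ι → Ω → S} (hξ : ∀ i, Measurable (ξ i))
    (hind : iIndepFun ξ P) (hlaw : ∀ i, P.map (ξ i) = Q) {u v : S → ℝ≥0} (hu : Measurable u)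
    (hv : Measurable v) (hv0 : ∀ᵐ s ∂Q, v s ≠ 0) {r : ℝ} (hr : 0 ≤ r) (b : ℝ) :
    P {ω | ENNReal.ofReal (Real.exp b) * ((∏ i, v (ξ i ω) : ℝ≥0) : ℝ≥0∞)
        ≤ ((∏ i, u (ξ i ω) : ℝ≥0) : ℝ≥0∞)}
      ≤ ENNReal.ofReal (Real.exp (-(r * b)))
        * (∫⁻ s, ((u s / v s : ℝ≥0) : ℝ≥0∞) ^ r ∂Q) ^ Fintype.card ι := by
  set R : Ω → ℝ≥0∞ := fun ω => ∏ i, ((u (ξ i ω) / v (ξ i ω) : ℝ≥0) : ℝ≥0∞) ^ r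
  have R_meas : Measurable R := by fun_prop
  have R_mean : ∫⁻ ω, R ω ∂P = (∫⁻ s, ((u s / v s : ℝ≥0) : ℝ≥0∞) ^ r ∂Q) ^ Fintype.card ι := by
    have hφ : Measurable fun s => ((u s / v s : ℝ≥0) : ℝ≥0∞) ^ r := by fun_prop
    have integral_prod := lintegral_prod_eq_prod_lintegral_of_indepFun Finset.univ
      (fun i ω => ((u (ξ i ω) / v (ξ i ω) : ℝ≥0) : ℝ≥0∞) ^ r)
      (hind.comp (fun _ s => ((u s / v s : ℝ≥0) : ℝ≥0∞) ^ r) fun _ => hφ)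
      fun i => hφ.comp (hξ i)
    rw [integral_prod, Finset.prod_congr rfl fun i _ => by rw [← lintegral_map hφ (hξ i), hlaw i],
      Finset.prod_const, Finset.card_univ]
  have v_ne_zero : ∀ᵐ ω ∂P, ∀ i, v (ξ i ω) ≠ 0 :=
    ae_all_iff.2 fun i => ae_of_ae_map (hξ i).aemeasurable (hlaw i ▸ hv0)
  calc _ ≤ P {ω | ENNReal.ofReal (Real.exp (r * b)) ≤ R ω} := by
        refine measure_mono_ae ?_
        filter_upwards [v_ne_zero] with ω hω hle
        have hprod : ∏ i, v (ξ i ω) ≠ 0 := Finset.prod_ne_zero_iff.2 fun i _ => hω i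
        have le_ratio : ENNReal.ofReal (Real.exp b)
            ≤ ((∏ i, (u (ξ i ω) / v (ξ i ω)) : ℝ≥0) : ℝ≥0∞) := by
          rw [Finset.prod_div_distrib, ENNReal.coe_div hprod,
            ENNReal.le_div_iff_mul_le (.inl (ENNReal.coe_ne_zero.2 hprod))
              (.inl ENNReal.coe_ne_top)]
          exact hle
        change _ ≤ ∏ i, _
        rw [ENNReal.prod_rpow_of_nonneg hr, ← ENNReal.ofNNReal_finsetProd, mul_comm, Real.exp_mul,
          ← ENNReal.ofReal_rpow_of_nonneg (Real.exp_pos b).le hr]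
        exact ENNReal.rpow_le_rpow le_ratio hr
    _ ≤ (∫⁻ ω, R ω ∂P) / ENNReal.ofReal (Real.exp (r * b)) :=
        meas_ge_le_lintegral_div R_meas.aemeasurable (by simp [Real.exp_pos])
          ENNReal.ofReal_ne_top
    _ = _ := by
        rw [R_mean, Real.exp_neg, ENNReal.ofReal_inv_of_pos (Real.exp_pos _), div_eq_mul_inv,
          mul_comm]

end LikelihoodRatio

attribute [instance] CondDist.isMarkov Policy.isMarkov MDP.init_isProbability MDP.trans_isMarkov
  MDP.cost_isMarkov

variable {H N : ℕ} {X A : Type*} [MeasurableSpace X] [MeasurableSpace A] {ρ : Measure ℝ}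

namespace CondDist

lemma measurable_density_apply (f : CondDist X A ρ) (p : X × A) : Measurable (f.density p) :=
  f.measurable_density.comp measurable_prodMk_left

lemma isProbabilityMeasure_withDensity (f : CondDist X A ρ) (p : X × A) :
    IsProbabilityMeasure (ρ.withDensity fun y => (f.density p y : ℝ≥0∞)) :=
  f.kernel_eq p ▸ inferInstance

lemma lintegral_kernel (f : CondDist X A ρ) (p : X × A) {φ : ℝ → ℝ≥0∞} (hφ : Measurable φ) :
    ∫⁻ y, φ y ∂(f.kernel p) = ∫⁻ y, f.density p y * φ y ∂ρ := by
  rw [f.kernel_eq p, lintegral_withDensity_eq_lintegral_mul _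
    (f.measurable_density_apply p).coe_nnreal_ennreal hφ]
  rfl

variable (m : Measure (X × A)) (f g : CondDist X A ρ)

lemma ae_density_ne_zero : ∀ᵐ q ∂(m ⊗ₘ g.kernel), g.density q.1 q.2 ≠ 0 := by
  refine Measure.ae_compProd_of_ae_ae
    (g.measurable_density (measurableSet_singleton 0)).compl (.of_forall fun p => ?_)
  rw [g.kernel_eq p, ae_withDensity_iff (g.measurable_density_apply p).coe_nnreal_ennreal]
  exact .of_forall fun y hy => by simpa using hy

lemma measurable_density_div :
    Measurable fun q : (X × A) × ℝ => f.density q.1 q.2 / g.density q.1 q.2 :=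
  f.measurable_density.div g.measurable_density

lemma lintegral_density_div_le_one [IsProbabilityMeasure m] :
    ∫⁻ q, ((f.density q.1 q.2 / g.density q.1 q.2 : ℝ≥0) : ℝ≥0∞) ∂(m ⊗ₘ g.kernel) ≤ 1 := by
  have hfg := (measurable_density_div f g).coe_nnreal_ennreal
  rw [Measure.lintegral_compProd hfg]
  calc _ ≤ ∫⁻ _, 1 ∂m := lintegral_mono fun p => ?_
    _ = 1 := by simp
  have hfgp : Measurable fun y => ((f.density p y / g.density p y : ℝ≥0) : ℝ≥0∞) :=
    hfg.comp measurable_prodMk_left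
  rw [g.lintegral_kernel p hfgp,
    ← lintegral_eq_one_of_withDensity (f.isProbabilityMeasure_withDensity p)]
  refine lintegral_mono fun y => ?_
  rw [← ENNReal.coe_mul, ENNReal.coe_le_coe]
  rcases eq_or_ne (g.density p y) 0 with hg | hg
  · simp [hg]
  · exact (mul_div_cancel₀ _ hg).le

lemma lintegral_sqrt_density_div [SFinite m] :
    ∫⁻ q, ((f.density q.1 q.2 / g.density q.1 q.2 : ℝ≥0) : ℝ≥0∞) ^ (2⁻¹ : ℝ) ∂(m ⊗ₘ g.kernel)
      = ∫⁻ p, affinity (f.kernel p) (g.kernel p) ∂m := by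
  have hfg := (measurable_density_div f g).coe_nnreal_ennreal.pow_const (2⁻¹ : ℝ)
  rw [Measure.lintegral_compProd hfg]
  refine lintegral_congr fun p => ?_
  have hfgp : Measurable fun y =>
      ((f.density p y / g.density p y : ℝ≥0) : ℝ≥0∞) ^ (2⁻¹ : ℝ) :=
    hfg.comp measurable_prodMk_left
  rw [g.lintegral_kernel p hfgp, f.kernel_eq p, g.kernel_eq p,
    affinity_withDensity ρ (f.measurable_density_apply p) (g.measurable_density_apply p)]
  refine lintegral_congr fun y => ?_
  rw [← ENNReal.coe_rpow_of_nonneg _ (by norm_num), ← ENNReal.coe_mul, ← one_div,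
    ← NNReal.sqrt_eq_rpow, mul_sqrt_div]

end CondDist

section Kernels

instance isMarkovKernel_follow (π : Kernel X A) (d : Kernel (X × A) ℝ) [IsMarkovKernel π]
    [IsMarkovKernel d] : IsMarkovKernel (follow π d) := by
  unfold follow; infer_instance

instance isMarkovKernel_terminal : IsMarkovKernel (terminal : Kernel X ℝ) := by
  unfold terminal; infer_instance

lemma follow_comp (m : Measure X) [SFinite m] (π : Kernel X A) [IsSFiniteKernel π]
    (d : Kernel (X × A) ℝ) : follow π d ∘ₘ m = d ∘ₘ (m ⊗ₘ π) := by
  rw [Measure.compProd_eq_comp_prod, Measure.comp_assoc, follow]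

lemma lintegral_follow (π : Kernel X A) (d : Kernel (X × A) ℝ) [IsSFiniteKernel π] (x : X)
    {φ : ℝ → ℝ≥0∞} (hφ : Measurable φ) :
    ∫⁻ y, φ y ∂(follow π d x) = ∫⁻ a, ∫⁻ y, φ y ∂(d (x, a)) ∂(π x) := by
  rw [follow, Kernel.lintegral_comp _ _ _ hφ, Kernel.lintegral_id_prod hφ.lintegral_kernel]

lemma lintegral_hellingerSq_follow_le (m : Measure X) [SFinite m] (π : Kernel X A)
    (d e : Kernel (X × A) ℝ) [IsMarkovKernel π] [IsFiniteKernel d] [IsFiniteKernel e] :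
    ∫⁻ x, hellingerSq (follow π d x) (follow π e x) ∂m
      ≤ ∫⁻ p, hellingerSq (d p) (e p) ∂(m ⊗ₘ π) := by
  have hde := measurable_hellingerSq d e
  rw [Measure.lintegral_compProd hde]
  refine lintegral_mono fun x => ?_
  rw [follow, follow, Kernel.comp_apply, Kernel.comp_apply, ← Kernel.lintegral_id_prod hde]
  exact hellingerSq_bind_le _ d e

variable (M : MDP H X A) (h : Fin H) (κ η : Kernel X ℝ)

lemma bellman_apply [IsSFiniteKernel κ] (p : X × A) :
    bellman M h κ p = M.cost h p ∗ κ ∘ₘ (M.trans h p) := by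
  rw [bellman, Kernel.map_apply _ (by fun_prop), Kernel.prod_apply, Kernel.comp_apply,
    Measure.conv]

lemma lintegral_bellman [IsMarkovKernel κ] (p : X × A) {φ : ℝ → ℝ≥0∞} (hφ : Measurable φ) :
    ∫⁻ y, φ y ∂(bellman M h κ p)
      = ∫⁻ c, ∫⁻ x, ∫⁻ y, φ (c + y) ∂(κ x) ∂(M.trans h p) ∂(M.cost h p) := by
  rw [bellman_apply, Measure.lintegral_conv hφ]
  refine lintegral_congr fun c => ?_
  rw [Measure.lintegral_bind (f := fun y => φ (c + y)) κ.aemeasurable (by fun_prop)]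

instance isMarkovKernel_bellman [IsMarkovKernel κ] : IsMarkovKernel (bellman M h κ) :=
  Kernel.IsMarkovKernel.map _ (by fun_prop)

lemma hellingerSq_bellman_le [IsMarkovKernel κ] [IsMarkovKernel η] (p : X × A) :
    hellingerSq (bellman M h κ p) (bellman M h η p)
      ≤ ∫⁻ x, hellingerSq (κ x) (η x) ∂(M.trans h p) := by
  rw [bellman_apply, bellman_apply]
  exact (hellingerSq_conv_left_le _ _ _).trans (hellingerSq_bind_le _ κ η)

end Kernels

section Rollout

variable (M : MDP H X A) (π : Policy H X A)

instance isProbabilityMeasure_rollIn (n : ℕ) : IsProbabilityMeasure (rollIn M π n) := by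
  induction n with
  | zero => unfold rollIn; infer_instance
  | succ n ih =>
    unfold rollIn
    split
    · exact Measure.isProbabilityMeasure_map (by fun_prop)
    · exact ih

/-- The law of the state reached after `n` steps of `π`. -/
def stateLaw (n : ℕ) : Measure X := (rollIn M π n).map Prod.fst

instance isProbabilityMeasure_stateLaw (n : ℕ) : IsProbabilityMeasure (stateLaw M π n) :=
  Measure.isProbabilityMeasure_map (by fun_prop)

lemma occupancy_eq (h : Fin H) : occupancy M π h = stateLaw M π h ⊗ₘ π.act h := rfl

instance isProbabilityMeasure_occupancy (h : Fin H) : IsProbabilityMeasure (occupancy M π h) := by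
  rw [occupancy_eq]; infer_instance

lemma lintegral_rollIn_zero {φ : X × ℝ → ℝ≥0∞} (hφ : Measurable φ) :
    ∫⁻ q, φ q ∂(rollIn M π 0) = ∫⁻ x, φ (x, 0) ∂M.init := by
  rw [rollIn, lintegral_prod _ hφ.aemeasurable]
  exact lintegral_congr fun x => lintegral_dirac' _ (hφ.comp measurable_prodMk_left)

lemma lintegral_rollIn_succ {n : ℕ} (hn : n < H) {φ : X × ℝ → ℝ≥0∞} (hφ : Measurable φ) :
    ∫⁻ q, φ q ∂(rollIn M π (n + 1))
      = ∫⁻ q, ∫⁻ a, ∫⁻ c, ∫⁻ x, φ (x, q.2 + c) ∂(M.trans ⟨n, hn⟩ (q.1, a))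
          ∂(M.cost ⟨n, hn⟩ (q.1, a)) ∂(π.act ⟨n, hn⟩ q.1) ∂(rollIn M π n) := by
  rw [rollIn, dif_pos hn, lintegral_map hφ (by fun_prop),
    Measure.lintegral_compProd (by fun_prop), Measure.lintegral_compProd]
  · refine lintegral_congr fun q => lintegral_congr fun a => ?_
    rw [Kernel.comap_apply, Kernel.lintegral_prod _ _ _ (by fun_prop)]
  · exact Measurable.lintegral_kernel_prod_right'
      (f := fun q : ((X × ℝ) × A) × ℝ × X => φ (q.2.2, q.1.1.2 + q.2.1)) (by fun_prop)

lemma stateLaw_zero : stateLaw M π 0 = M.init := by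
  rw [stateLaw, rollIn, Measure.map_fst_prod, measure_univ, one_smul]

lemma stateLaw_succ (h : Fin H) :
    stateLaw M π (h + 1) = M.trans h ∘ₘ occupancy M π h := by
  refine Measure.ext_of_lintegral _ fun φ hφ => ?_
  have hφ_trans : Measurable fun p => ∫⁻ x, φ x ∂(M.trans h p) := hφ.lintegral_kernel
  rw [stateLaw, lintegral_map hφ measurable_fst,
    lintegral_rollIn_succ M π h.2 (φ := fun q => φ q.1) (by fun_prop),
    Measure.lintegral_bind (M.trans h).aemeasurable hφ.aemeasurable, occupancy_eq,
    Measure.lintegral_compProd hφ_trans, stateLaw,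
    lintegral_map hφ_trans.lintegral_kernel_prod_right' measurable_fst]
  simp

open Classical in
lemma lintegral_occupancy_le (ν : Fin H → Measure (X × A)) [∀ h, SigmaFinite (ν h)]
    (hC : concentrability M ν π ≠ ∞) (h : Fin H) {φ : X × A → ℝ≥0∞} (hφ : Measurable φ) :
    ∫⁻ p, φ p ∂(occupancy M π h) ≤ concentrability M ν π * ∫⁻ p, φ p ∂(ν h) := by
  have le_concentrability := le_iSup (fun h => if occupancy M π h ≪ ν h then
    essSup ((occupancy M π h).rnDeriv (ν h)) (ν h) else ∞) h
  change _ ≤ concentrability M ν π at le_concentrability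
  have hac : occupancy M π h ≪ ν h := by
    by_contra hac
    rw [if_neg hac, top_le_iff] at le_concentrability
    exact hC le_concentrability
  rw [if_pos hac] at le_concentrability
  rw [← lintegral_rnDeriv_mul hac hφ.aemeasurable, ← lintegral_const_mul _ hφ]
  refine lintegral_mono_ae ?_
  filter_upwards [ENNReal.ae_le_essSup ((occupancy M π h).rnDeriv (ν h))] with p hp
  gcongr
  exact hp.trans le_concentrability

end Rollout

section Bellman

variable (M : MDP H X A) (π : Policy H X A) (f Z : Fin H → CondDist X A ρ)

/-- The candidate `f`'s prediction, given the state after `n` steps, of the law of the cost still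
to be collected by `π`; it extends `continuation`, which starts at `n = 1`, to the initial state. -/
def costToGo (n : ℕ) : Kernel X ℝ :=
  if hn : n < H then follow (π.act ⟨n, hn⟩) (f ⟨n, hn⟩).kernel else terminal

instance isMarkovKernel_costToGo (n : ℕ) : IsMarkovKernel (costToGo π f n) := by
  unfold costToGo; split <;> infer_instance

variable {f} in
lemma costToGo_of_lt {n : ℕ} (hn : n < H) :
    costToGo π f n = follow (π.act ⟨n, hn⟩) (f ⟨n, hn⟩).kernel :=
  dif_pos hn

lemma costToGo_horizon : costToGo π f H = terminal :=
  dif_neg (lt_irrefl H)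

lemma continuation_eq_costToGo (h : Fin H) : continuation π f h = costToGo π f (h + 1) := rfl

instance isMarkovKernel_continuation (h : Fin H) : IsMarkovKernel (continuation π f h) :=
  isMarkovKernel_costToGo π f (h + 1)

lemma continuation_update {j h : Fin H} (hjh : j ≤ h) (d : CondDist X A ρ) :
    continuation π (Function.update f j d) h = continuation π f h := by
  unfold continuation
  split
  · rw [Function.update_of_ne (fun e => by simp [← e, Fin.le_def] at hjh)]
  · rfl

/-- `f` is a fixed point of the distributional Bellman operator of `π`, so that `f_h(x, a)` is the
law of the cost collected by `π` from step `h` on. -/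
def IsBellmanFixed : Prop := ∀ h, (f h).kernel = bellman M h (continuation π f h)

/-- The squared Hellinger distance at `p = (x, a)` between the candidate `f_h` and the Bellman
backup of `f_{h+1}`. -/
def bellmanError (h : Fin H) (p : X × A) : ℝ≥0∞ :=
  hellingerSq ((f h).kernel p) (bellman M h (continuation π f h) p)

lemma measurable_bellmanError (h : Fin H) : Measurable (bellmanError M π f h) :=
  measurable_hellingerSq _ _

section Complete

variable {M π f} {Pi : Finset (Policy H X A)} {F : Fin H → Finset (CondDist X A ρ)}

lemma exists_backup (hF : BellmanComplete M Pi F) (hπ : π ∈ Pi) {h : Fin H}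
    (hf : ∀ j > h, f j ∈ F j) : ∃ d ∈ F h, d.kernel = bellman M h (continuation π f h) := by
  by_cases hh : (h : ℕ) + 1 < H
  · rw [continuation, dif_pos hh]
    exact hF.step π hπ h hh _ (hf _ (Fin.lt_def.2 (Nat.lt_succ_self _)))
  · rw [continuation, dif_neg hh]
    exact hF.last h (by omega)

lemma exists_isBellmanFixed (hF : BellmanComplete M Pi F) (hπ : π ∈ Pi) :
    ∃ Z ∈ Fintype.piFinset F, IsBellmanFixed M π Z := by
  suffices key : ∀ n ≤ H, ∃ Z : Fin H → CondDist X A ρ, ∀ h : Fin H, n ≤ h →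
      Z h ∈ F h ∧ (Z h).kernel = bellman M h (continuation π Z h) by
    obtain ⟨Z, hZ⟩ := key 0 H.zero_le
    exact ⟨Z, Fintype.mem_piFinset.2 fun h => (hZ h (Nat.zero_le _)).1,
      fun h => (hZ h (Nat.zero_le _)).2⟩
  intro n hn
  induction hn using Nat.decreasingInduction with
  | self =>
    have candidate (h : Fin H) : CondDist X A ρ :=
      (hF.last ⟨H - 1, Nat.sub_one_lt_of_lt h.2⟩ (Nat.sub_add_cancel h.pos)).choose
    exact ⟨candidate, fun h hh => absurd h.2 hh.not_gt⟩
  | of_succ n hn ih =>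
    obtain ⟨Z, hZ⟩ := ih
    obtain ⟨d, hd, d_eq⟩ := exists_backup hF hπ (h := ⟨n, hn⟩) fun j hj => (hZ j hj).1
    refine ⟨Function.update Z ⟨n, hn⟩ d, fun h hh => ?_⟩
    rw [continuation_update π Z (Fin.le_def.2 hh)]
    rcases eq_or_ne h ⟨n, hn⟩ with rfl | hne
    · rw [Function.update_self]
      exact ⟨hd, d_eq⟩
    · rw [Function.update_of_ne hne]
      exact hZ h (lt_of_le_of_ne hh fun e => hne (Fin.ext e.symm))

end Complete

/-- The law of the return of `π` that the candidate `f` predicts. -/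
def predictedLaw : Measure ℝ := costToGo π f 0 ∘ₘ M.init

instance isProbabilityMeasure_predictedLaw : IsProbabilityMeasure (predictedLaw M π f) := by
  unfold predictedLaw; infer_instance

lemma predictedLaw_eq [NeZero H] :
    predictedLaw M π f = (f 0).kernel ∘ₘ (M.init ⊗ₘ π.act 0) := by
  rw [predictedLaw, costToGo_of_lt π (NeZero.pos H), follow_comp]
  rfl

lemma predictedLaw_mem_unit [NeZero H] : ∀ᵐ y ∂(predictedLaw M π f), y ∈ Set.Icc (0 : ℝ) 1 := by
  rw [predictedLaw_eq]
  exact Measure.ae_comp_of_ae_ae measurableSet_Icc (.of_forall (f 0).mem_unit)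

lemma estimate_eq_integral_predictedLaw [NeZero H] :
    estimate M π f = ∫ y, y ∂(predictedLaw M π f) := by
  have integrable_id : Integrable (fun y : ℝ => y) (predictedLaw M π f) :=
    .of_mem_Icc 0 1 aemeasurable_id (predictedLaw_mem_unit M π f)
  rw [predictedLaw_eq, Measure.comp_eq_comp_const_apply] at integrable_id ⊢
  have integrable_mean := integrable_id.integral_comp
  rw [Kernel.const_apply] at integrable_mean
  rw [Kernel.integral_comp integrable_id, Kernel.const_apply,
    Measure.integral_compProd integrable_mean]
  rfl

lemma measurable_lintegral_add (κ : Kernel X ℝ) [IsSFiniteKernel κ] {φ : ℝ → ℝ≥0∞}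
    (hφ : Measurable φ) : Measurable fun q : X × ℝ => ∫⁻ y, φ (q.2 + y) ∂(κ q.1) :=
  Measurable.lintegral_kernel_prod_right' (κ := κ.comap (Prod.fst : X × ℝ → X) measurable_fst)
    (f := fun q : (X × ℝ) × ℝ => φ (q.1.2 + q.2)) (by fun_prop)

variable {M π f Z}

lemma lintegral_rollIn_costToGo (hZ : IsBellmanFixed M π Z) {φ : ℝ → ℝ≥0∞} (hφ : Measurable φ)
    {n : ℕ} (hn : n ≤ H) :
    ∫⁻ q, ∫⁻ y, φ (q.2 + y) ∂(costToGo π Z n q.1) ∂(rollIn M π n)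
      = ∫⁻ z, φ z ∂(returnLaw M π) := by
  induction hn using Nat.decreasingInduction with
  | self =>
    rw [returnLaw, lintegral_map hφ measurable_snd]
    refine lintegral_congr fun q => ?_
    rw [costToGo_horizon, terminal, Kernel.const_apply, lintegral_dirac' _ (by fun_prop), add_zero]
  | of_succ n hn ih =>
    rw [← ih, lintegral_rollIn_succ M π hn (measurable_lintegral_add _ hφ)]
    refine lintegral_congr fun q => ?_
    rw [costToGo_of_lt π hn, lintegral_follow _ _ _ (by fun_prop)]
    refine lintegral_congr fun a => ?_
    rw [hZ, lintegral_bellman _ _ _ _ (by fun_prop)]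
    simp only [continuation_eq_costToGo, add_assoc]

lemma predictedLaw_eq_returnLaw (hZ : IsBellmanFixed M π Z) :
    predictedLaw M π Z = returnLaw M π := by
  refine Measure.ext_of_lintegral _ fun φ hφ => ?_
  rw [← lintegral_rollIn_costToGo hZ hφ H.zero_le,
    lintegral_rollIn_zero M π (measurable_lintegral_add _ hφ), predictedLaw,
    Measure.lintegral_bind (Kernel.aemeasurable _) hφ.aemeasurable]
  simp only [zero_add]

lemma estimate_eq_value [NeZero H] (hZ : IsBellmanFixed M π Z) : estimate M π Z = value M π := by
  rw [estimate_eq_integral_predictedLaw, predictedLaw_eq_returnLaw hZ, value]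

lemma lintegral_hellingerSq_kernel_le (hZ : IsBellmanFixed M π Z) (h : Fin H) (k : ℝ≥0∞) :
    ∫⁻ p, hellingerSq ((f h).kernel p) ((Z h).kernel p) ∂(occupancy M π h)
      ≤ (1 + k) * ∫⁻ p, bellmanError M π f h p ∂(occupancy M π h)
        + (1 + k⁻¹) * ∫⁻ x, hellingerSq (costToGo π f (h + 1) x) (costToGo π Z (h + 1) x)
            ∂(stateLaw M π (h + 1)) := by
  have hbf := measurable_bellmanError M π f h
  have hfZ := measurable_hellingerSq (costToGo π f (h + 1)) (costToGo π Z (h + 1))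
  rw [stateLaw_succ, Measure.lintegral_bind (M.trans h).aemeasurable hfZ.aemeasurable,
    ← lintegral_const_mul _ hbf, ← lintegral_const_mul _ hfZ.lintegral_kernel,
    ← lintegral_add_left (hbf.const_mul _)]
  refine lintegral_mono fun p => ?_
  refine (hellingerSq_triangle _ (bellman M h (continuation π f h) p) _ k).trans ?_
  rw [hZ h]
  gcongr
  · rfl
  · exact hellingerSq_bellman_le M h _ _ p

-- Hellinger distances add up along the horizon, so the squared distance grows quadratically in the
-- number `H - n` of remaining steps: the weight `k = H - n - 1` solves
-- `(1 + k) + (1 + 1/k) k² = (k + 1)²`.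
lemma lintegral_hellingerSq_costToGo_le (hZ : IsBellmanFixed M π Z) {ε : ℝ≥0∞}
    (hε : ∀ h, ∫⁻ p, bellmanError M π f h p ∂(occupancy M π h) ≤ ε) {n : ℕ} (hn : n ≤ H) :
    ∫⁻ x, hellingerSq (costToGo π f n x) (costToGo π Z n x) ∂(stateLaw M π n)
      ≤ (H - n : ℕ) ^ 2 * ε := by
  induction hn using Nat.decreasingInduction with
  | self => simp only [costToGo_horizon, hellingerSq_self, lintegral_zero, zero_le]
  | of_succ n hn ih =>
    obtain ⟨k, rfl⟩ := Nat.exists_eq_add_of_lt hn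
    have weights : (1 + (k : ℝ≥0∞)) + (1 + (k : ℝ≥0∞)⁻¹) * k ^ 2 = (k + 1) ^ 2 := by
      rcases eq_or_ne k 0 with rfl | hk
      · simp
      · have inv_mul_sq : (k : ℝ≥0∞)⁻¹ * k ^ 2 = k := by
          rw [sq, ENNReal.inv_mul_cancel_left (by simpa) (by simp)]
        rw [add_mul, inv_mul_sq]
        ring
    have steps_succ : n + k + 1 - (n + 1) = k := by omega
    have steps : n + k + 1 - n = k + 1 := by omega
    rw [steps_succ] at ih
    rw [costToGo_of_lt π hn, costToGo_of_lt π hn, steps]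
    calc _ ≤ ∫⁻ p, hellingerSq ((f ⟨n, hn⟩).kernel p) ((Z ⟨n, hn⟩).kernel p)
              ∂(occupancy M π ⟨n, hn⟩) := lintegral_hellingerSq_follow_le _ _ _ _
      _ ≤ (1 + k) * ε + (1 + (k : ℝ≥0∞)⁻¹) * (k ^ 2 * ε) := by
        refine (lintegral_hellingerSq_kernel_le hZ _ k).trans ?_
        gcongr
        exact hε _
      _ = _ := by
        push_cast
        rw [← weights]
        ring

lemma hellingerSq_predictedLaw_le (hZ : IsBellmanFixed M π Z) {ε : ℝ≥0∞}
    (hε : ∀ h, ∫⁻ p, bellmanError M π f h p ∂(occupancy M π h) ≤ ε) :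
    hellingerSq (predictedLaw M π f) (predictedLaw M π Z) ≤ H ^ 2 * ε := by
  refine (hellingerSq_bind_le M.init _ _).trans ?_
  rw [← stateLaw_zero M π]
  exact lintegral_hellingerSq_costToGo_le hZ hε H.zero_le

lemma estimate_sub_value_le [NeZero H] {ν : Fin H → Measure (X × A)} [∀ h, SigmaFinite (ν h)]
    (hC : concentrability M ν π ≠ ∞) (hZ : IsBellmanFixed M π Z) {ε : ℝ} (hε0 : 0 ≤ ε)
    (hε : ∀ h, ∫⁻ p, bellmanError M π f h p ∂(ν h) ≤ ENNReal.ofReal ε) :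
    estimate M π f - value M π
      ≤ 4 * (√(returnVar M π * (H ^ 2 * (concentrability M ν π).toReal * ε))
        + H ^ 2 * (concentrability M ν π).toReal * ε) := by
  set C := concentrability M ν π
  have error_le (h : Fin H) :
      ∫⁻ p, bellmanError M π f h p ∂(occupancy M π h) ≤ C * ENNReal.ofReal ε :=
    (lintegral_occupancy_le M π ν hC h (measurable_bellmanError M π f h)).trans
      (mul_le_mul_right (hε h) C)
  have distance_le : (hellingerSq (predictedLaw M π f) (predictedLaw M π Z)).toReal
      ≤ H ^ 2 * C.toReal * ε := by
    refine (ENNReal.toReal_mono (by finiteness)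
      (hellingerSq_predictedLaw_le hZ error_le)).trans_eq ?_
    simp [ENNReal.toReal_ofReal hε0, mul_assoc]
  have mean_le := abs_integral_sub_le_of_mem_unit aestronglyMeasurable_id aestronglyMeasurable_id
    (predictedLaw_mem_unit M π f) (predictedLaw_mem_unit M π Z)
  simp only [id] at mean_le
  rw [estimate_eq_integral_predictedLaw, ← estimate_eq_value hZ, estimate_eq_integral_predictedLaw]
  refine (le_abs_self _).trans (mean_le.trans ?_)
  rw [returnVar, ← predictedLaw_eq_returnLaw hZ]
  have V_nonneg := variance_nonneg id (predictedLaw M π Z)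
  gcongr

end Bellman

section Likelihood

/-- The `i`-th sample `((x, a), z)` at step `h` of the regression problem posed by `π` and `f`,
with target `z = c + y`. -/
def Dataset.sample (D : Dataset H N X A ρ) (π : Policy H X A) (f : Fin H → CondDist X A ρ)
    (h : Fin H) (i : Fin N) : (X × A) × ℝ :=
  (D.xa h i, D.c h i + D.y π f h i)

/-- The likelihood of `g` on the samples of `π` and `f` at step `h`, whose logarithm is
`logLik`. -/
def lik (D : Dataset H N X A ρ) (π : Policy H X A) (f : Fin H → CondDist X A ρ) (h : Fin H)
    (g : CondDist X A ρ) : ℝ≥0 :=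
  ∏ i, g.density (D.sample π f h i).1 (D.sample π f h i).2

variable {F : Fin H → Finset (CondDist X A ρ)} {β : ℝ} {π : Policy H X A}
  {f : Fin H → CondDist X A ρ}

lemma logLik_eq (D : Dataset H N X A ρ) (h : Fin H) (g : CondDist X A ρ) :
    logLik D π f h g = ENNReal.log (lik D π f h g) := by
  have log_prod (s : Finset (Fin N)) (u : Fin N → ℝ≥0) :
      ∑ i ∈ s, ENNReal.log (u i) = ENNReal.log ((∏ i ∈ s, u i : ℝ≥0) : ℝ≥0∞) := by
    induction s using Finset.cons_induction with
    | empty => simp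
    | cons a s ha ih =>
      rw [Finset.sum_cons, Finset.prod_cons, ENNReal.coe_mul, ENNReal.log_mul_add, ih]
  exact log_prod _ _

lemma mem_confSet_iff {D : Dataset H N X A ρ} :
    f ∈ confSet F β D π ↔ f ∈ Fintype.piFinset F ∧ ∀ h, ∀ g ∈ F h,
      (lik D π f h g : ℝ≥0∞) ≤ ENNReal.ofReal (Real.exp β) * lik D π f h (f h) := by
  have β_eq : (β : EReal) = ENNReal.log (ENNReal.ofReal (Real.exp β)) := by
    rw [ENNReal.log_ofReal_of_pos (Real.exp_pos β), Real.log_exp]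
  refine and_congr_right fun _ => forall_congr' fun h => ?_
  rw [EReal.sub_le_iff_le_add (.inl (EReal.coe_ne_bot β)) (.inl (EReal.coe_ne_top β)),
    iSup₂_le_iff]
  refine forall₂_congr fun g _ => ?_
  rw [logLik_eq, logLik_eq, β_eq, ← ENNReal.log_mul_add, ENNReal.log_le_log_iff, mul_comm]

variable (π f)

lemma map_sampleLaw (M : MDP H X A) (ν : Fin H → Measure (X × A)) (h : Fin H) [SFinite (ν h)] :
    (sampleLaw M ν π f h).map (fun s => (s.1, s.2.1.1 + s.2.2))
      = ν h ⊗ₘ bellman M h (continuation π f h) := by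
  refine Measure.ext_of_lintegral _ fun φ hφ => ?_
  rw [lintegral_map hφ (by fun_prop), sampleLaw, Measure.lintegral_compProd (by fun_prop),
    Measure.lintegral_compProd hφ]
  refine lintegral_congr fun p => ?_
  have cost_next_meas : Measurable fun b : ℝ × X =>
      ∫⁻ y, φ (p, b.1 + y) ∂(continuation π f h b.2) :=
    (measurable_lintegral_add (continuation π f h) (φ := fun z => φ (p, z)) (by fun_prop)).comp
      measurable_swap
  rw [lintegral_bellman M h _ p (by fun_prop), Kernel.lintegral_compProd _ _ _ (by fun_prop)]
  simp only [Kernel.comap_apply]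
  rw [Kernel.lintegral_prod _ _ _ cost_next_meas]

end Likelihood

section Data

variable {Ω : Type*} [MeasurableSpace Ω] {P : Measure Ω} {M : MDP H X A}
  {ν : Fin H → Measure (X × A)} {Pi : Finset (Policy H X A)} {F : Fin H → Finset (CondDist X A ρ)}
  {D : Ω → Dataset H N X A ρ} {π : Policy H X A} {f : Fin H → CondDist X A ρ} {h : Fin H}
  {g : CondDist X A ρ}

namespace IsOfflineData

lemma measurable_sample (hD : IsOfflineData P M ν Pi F D) (hπ : π ∈ Pi)
    (hf : f ∈ Fintype.piFinset F) (h : Fin H) (i : Fin N) :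
    Measurable fun ω => (D ω).sample π f h i :=
  (by fun_prop : Measurable fun s : (X × A) × (ℝ × X) × ℝ => (s.1, s.2.1.1 + s.2.2)).comp
    ((hD π hπ f hf h).1 i)

lemma iIndepFun_sample (hD : IsOfflineData P M ν Pi F D) (hπ : π ∈ Pi)
    (hf : f ∈ Fintype.piFinset F) (h : Fin H) :
    iIndepFun (fun i ω => (D ω).sample π f h i) P :=
  (hD π hπ f hf h).2.1.comp (fun _ s => (s.1, s.2.1.1 + s.2.2)) fun _ => by fun_prop

lemma map_sample [SFinite (ν h)] (hD : IsOfflineData P M ν Pi F D) (hπ : π ∈ Pi)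
    (hf : f ∈ Fintype.piFinset F) (i : Fin N) :
    P.map (fun ω => (D ω).sample π f h i) = ν h ⊗ₘ bellman M h (continuation π f h) := by
  obtain ⟨raw_meas, -, raw_law⟩ := hD π hπ f hf h
  rw [← map_sampleLaw, ← raw_law i, Measure.map_map (by fun_prop) (raw_meas i)]
  rfl

lemma measure_exp_mul_lik_le_lik_le [SFinite (ν h)] (hD : IsOfflineData P M ν Pi F D)
    (hπ : π ∈ Pi) (hf : f ∈ Fintype.piFinset F)
    (hg : g.kernel = bellman M h (continuation π f h)) (k : CondDist X A ρ) {r : ℝ} (hr : 0 ≤ r)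
    (b : ℝ) :
    P {ω | ENNReal.ofReal (Real.exp b) * lik (D ω) π f h g ≤ lik (D ω) π f h k}
      ≤ ENNReal.ofReal (Real.exp (-(r * b)))
        * (∫⁻ q, ((k.density q.1 q.2 / g.density q.1 q.2 : ℝ≥0) : ℝ≥0∞) ^ r
            ∂(ν h ⊗ₘ g.kernel)) ^ N := by
  have test_le := measure_exp_mul_prod_le_prod_le (hD.measurable_sample hπ hf h)
    (hD.iIndepFun_sample hπ hf h) (fun i => (hD.map_sample hπ hf i).trans (by rw [hg]))
    k.measurable_density g.measurable_density (g.ae_density_ne_zero (ν h)) hr b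
  rwa [Fintype.card_fin] at test_le

lemma measure_exp_mul_lik_le_lik_le_exp_neg [IsProbabilityMeasure (ν h)]
    (hD : IsOfflineData P M ν Pi F D) (hπ : π ∈ Pi) (hf : f ∈ Fintype.piFinset F)
    (hg : g.kernel = bellman M h (continuation π f h)) (k : CondDist X A ρ) (β : ℝ) :
    P {ω | ENNReal.ofReal (Real.exp β) * lik (D ω) π f h g ≤ lik (D ω) π f h k}
      ≤ ENNReal.ofReal (Real.exp (-β)) := by
  refine (hD.measure_exp_mul_lik_le_lik_le hπ hf hg k zero_le_one β).trans ?_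
  simp only [ENNReal.rpow_one, one_mul]
  exact mul_le_of_le_one_right' (pow_le_one₀ zero_le (k.lintegral_density_div_le_one (ν h) g))

lemma measure_lik_le_exp_mul_lik_le_exp [IsProbabilityMeasure (ν h)]
    (hD : IsOfflineData P M ν Pi F D) (hπ : π ∈ Pi) (hf : f ∈ Fintype.piFinset F)
    (hg : g.kernel = bellman M h (continuation π f h)) (k : CondDist X A ρ) (β : ℝ) {ε : ℝ}
    (hε0 : 0 ≤ ε) (hε : ENNReal.ofReal ε ≤ ∫⁻ p, hellingerSq (k.kernel p) (g.kernel p) ∂(ν h)) :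
    P {ω | (lik (D ω) π f h g : ℝ≥0∞) ≤ ENNReal.ofReal (Real.exp β) * lik (D ω) π f h k}
      ≤ ENNReal.ofReal (Real.exp (β / 2 - N * ε)) := by
  have affinity_le : ∫⁻ p, affinity (k.kernel p) (g.kernel p) ∂(ν h)
      ≤ ENNReal.ofReal (Real.exp (-ε)) := by
    have integral_add : ∫⁻ p, affinity (k.kernel p) (g.kernel p) ∂(ν h)
        + ∫⁻ p, hellingerSq (k.kernel p) (g.kernel p) ∂(ν h) = 1 := by
      rw [← lintegral_add_left (measurable_affinity _ _)]
      simp [affinity_add_hellingerSq]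
    calc _ ≤ 1 - ENNReal.ofReal ε :=
          ENNReal.le_sub_of_add_le_right ENNReal.ofReal_ne_top
            ((add_le_add_right hε _).trans_eq integral_add)
      _ = ENNReal.ofReal (1 - ε) := by rw [ENNReal.ofReal_sub _ hε0, ENNReal.ofReal_one]
      _ ≤ _ := ENNReal.ofReal_le_ofReal (Real.one_sub_le_exp_neg ε)
  calc _ ≤ P {ω | ENNReal.ofReal (Real.exp (-β)) * lik (D ω) π f h g ≤ lik (D ω) π f h k} := by
        refine measure_mono fun ω hω => ?_
        refine (mul_le_mul_right (Set.mem_ofPred.1 hω) _).trans_eq ?_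
        rw [← mul_assoc, ← ENNReal.ofReal_mul (Real.exp_pos _).le, ← Real.exp_add]
        simp
    _ ≤ ENNReal.ofReal (Real.exp (-(2⁻¹ * -β))) * ENNReal.ofReal (Real.exp (-ε)) ^ N := by
        refine (hD.measure_exp_mul_lik_le_lik_le hπ hf hg k (inv_nonneg.2 zero_le_two)
          (-β)).trans ?_
        rw [k.lintegral_sqrt_density_div (ν h) g]
        gcongr
    _ = _ := by
        rw [← ENNReal.ofReal_pow (Real.exp_pos _).le, ← Real.exp_nat_mul,
          ← ENNReal.ofReal_mul (Real.exp_pos _).le, ← Real.exp_add]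
        ring_nf

end IsOfflineData

lemma card_le_card_piFinset {ι : Type*} [Fintype ι] [DecidableEq ι] {α : ι → Type*}
    {s : ∀ i, Finset (α i)} (hs : (Fintype.piFinset s).Nonempty) (i : ι) :
    (s i).card ≤ (Fintype.piFinset s).card := by
  classical
  obtain ⟨a, ha⟩ := hs
  rw [← Fintype.eval_image_piFinset s i fun j _ => ⟨a j, Fintype.mem_piFinset.1 ha j⟩]
  exact Finset.card_image_le

/-- The confidence set of `π` contains the conditional return laws of `π`, and all its elements
have mean Bellman error at most `ε` on the data distributions. -/
def IsSoundConfSet (M : MDP H X A) (ν : Fin H → Measure (X × A))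
    (F : Fin H → Finset (CondDist X A ρ)) (β : ℝ) (D : Dataset H N X A ρ) (π : Policy H X A)
    (ε : ℝ) : Prop :=
  (∃ Z ∈ confSet F β D π, IsBellmanFixed M π Z) ∧
    ∀ f ∈ confSet F β D π, ∀ h, ∫⁻ p, bellmanError M π f h p ∂(ν h) ≤ ENNReal.ofReal ε

namespace IsOfflineData

variable {β : ℝ}

lemma measure_notMem_confSet_le [∀ h, IsProbabilityMeasure (ν h)]
    (hD : IsOfflineData P M ν Pi F D) (hπ : π ∈ Pi) {Z : Fin H → CondDist X A ρ}
    (hZF : Z ∈ Fintype.piFinset F) (hZ : IsBellmanFixed M π Z) (hβ : 0 ≤ β) :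
    P {ω | Z ∉ confSet F β (D ω) π}
      ≤ ENNReal.ofReal (H * (((Fintype.piFinset F).card - 1) * Real.exp (-β))) := by
  classical
  -- `Z h` never rejects itself, which saves one test per step and absorbs the failure probability
  -- of `measure_far_mem_confSet_le`.
  have rejection_subset : {ω | Z ∉ confSet F β (D ω) π} ⊆ ⋃ h, ⋃ k ∈ (F h).erase (Z h),
      {ω | ENNReal.ofReal (Real.exp β) * lik (D ω) π Z h (Z h) ≤ lik (D ω) π Z h k} := by
    intro ω hω
    simp only [Set.mem_ofPred_eq, mem_confSet_iff, hZF, true_and, not_forall, not_le] at hω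
    obtain ⟨h, k, hk, hlt⟩ := hω
    have k_ne : k ≠ Z h := by
      rintro rfl
      exact hlt.not_ge (le_mul_of_one_le_left zero_le
        (ENNReal.one_le_ofReal.2 (Real.one_le_exp hβ)))
    simp only [Set.mem_iUnion]
    exact ⟨h, k, Finset.mem_erase.2 ⟨k_ne, hk⟩, hlt.le⟩
  have n_pos : 0 < (Fintype.piFinset F).card := Finset.card_pos.2 ⟨Z, hZF⟩
  refine (measure_mono rejection_subset).trans ((measure_iUnion_fintype_le _ _).trans ?_)
  calc _ ≤ ∑ _h : Fin H, ((Fintype.piFinset F).card - 1) • ENNReal.ofReal (Real.exp (-β)) :=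
        Finset.sum_le_sum fun h _ => (measure_biUnion_finset_le _ _).trans <|
          (Finset.sum_le_card_nsmul _ _ _ fun k _ =>
            hD.measure_exp_mul_lik_le_lik_le_exp_neg hπ hZF (hZ h) k β).trans <| by
          rw [Finset.card_erase_of_mem (Fintype.mem_piFinset.1 hZF h)]
          gcongr
          exact card_le_card_piFinset ⟨Z, hZF⟩ h
    _ = _ := by
        rw [← Nat.cast_pred n_pos]
        simp [ENNReal.ofReal_mul, -Fintype.card_piFinset]

lemma measure_far_mem_confSet_le [∀ h, IsProbabilityMeasure (ν h)]
    (hD : IsOfflineData P M ν Pi F D) (hF : BellmanComplete M Pi F) (hπ : π ∈ Pi) {ε : ℝ}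
    (hε : 0 ≤ ε) :
    P {ω | ∃ f ∈ confSet F β (D ω) π,
        ∃ h, ENNReal.ofReal ε < ∫⁻ p, bellmanError M π f h p ∂(ν h)}
      ≤ (Fintype.piFinset F).card * (H * ENNReal.ofReal (Real.exp (β / 2 - N * ε))) := by
  have accept_le (f) (hf : f ∈ Fintype.piFinset F) (h : Fin H) :
      P {ω | f ∈ confSet F β (D ω) π ∧
          ENNReal.ofReal ε < ∫⁻ p, bellmanError M π f h p ∂(ν h)}
        ≤ ENNReal.ofReal (Real.exp (β / 2 - N * ε)) := by
    obtain ⟨g, hgF, hg⟩ := exists_backup hF hπ (h := h) fun j _ => Fintype.mem_piFinset.1 hf j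
    by_cases hfar : ENNReal.ofReal ε < ∫⁻ p, bellmanError M π f h p ∂(ν h)
    · simp only [hfar, and_true]
      have far : ENNReal.ofReal ε ≤ ∫⁻ p, hellingerSq ((f h).kernel p) (g.kernel p) ∂(ν h) :=
        hg ▸ hfar.le
      refine le_trans (measure_mono fun ω (hω : f ∈ confSet F β (D ω) π) => ?_)
        (hD.measure_lik_le_exp_mul_lik_le_exp hπ hf hg (f h) β hε far)
      exact (mem_confSet_iff.1 hω).2 h g hgF
    · simp [hfar]
  calc _ ≤ P (⋃ f ∈ Fintype.piFinset F, ⋃ h, {ω | f ∈ confSet F β (D ω) π ∧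
          ENNReal.ofReal ε < ∫⁻ p, bellmanError M π f h p ∂(ν h)}) := by
        refine measure_mono fun ω => ?_
        rintro ⟨f, hf, h, hfar⟩
        simp only [Set.mem_iUnion]
        exact ⟨f, hf.1, h, hf, hfar⟩
    _ ≤ ∑ f ∈ Fintype.piFinset F, ∑ _h : Fin H, ENNReal.ofReal (Real.exp (β / 2 - N * ε)) :=
        (measure_biUnion_finset_le _ _).trans <| Finset.sum_le_sum fun f hf =>
          (measure_iUnion_fintype_le _ _).trans <| Finset.sum_le_sum fun h _ => accept_le f hf h
    _ = _ := by simp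

-- The radius `5 β / (2 N)` makes the Chernoff bound for accepting a far candidate equal to
-- `exp (-2 β)`, and `(n - 1) q + n q² ≤ n q` for `q = exp (-β)` as soon as `n q ≤ 1`.
lemma measure_not_isSoundConfSet_le [∀ h, IsProbabilityMeasure (ν h)] (hN : 0 < N)
    (hD : IsOfflineData P M ν Pi F D) (hF : BellmanComplete M Pi F) (hπ : π ∈ Pi)
    (hβ0 : 0 ≤ β) (hβ : (Fintype.piFinset F).card * Real.exp (-β) ≤ 1) :
    P {ω | ¬ IsSoundConfSet M ν F β (D ω) π (5 * β / (2 * N))}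
      ≤ ENNReal.ofReal (H * (Fintype.piFinset F).card * Real.exp (-β)) := by
  obtain ⟨Z, hZF, hZ⟩ := exists_isBellmanFixed hF hπ
  set n := (Fintype.piFinset F).card
  set q := Real.exp (-β)
  have n_pos : 1 ≤ n := Finset.card_pos.2 ⟨Z, hZF⟩
  have reject_le : P {ω | Z ∉ confSet F β (D ω) π} ≤ ENNReal.ofReal (H * ((n - 1) * q)) :=
    hD.measure_notMem_confSet_le hπ hZF hZ hβ0
  have accept_le : P {ω | ∃ f ∈ confSet F β (D ω) π,
      ∃ h, ENNReal.ofReal (5 * β / (2 * N)) < ∫⁻ p, bellmanError M π f h p ∂(ν h)}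
        ≤ ENNReal.ofReal (H * (n * q * q)) := by
    refine (hD.measure_far_mem_confSet_le hF hπ (by positivity)).trans_eq ?_
    have exponent_eq : β / 2 - N * (5 * β / (2 * N)) = -β + -β := by field_simp; ring
    change (n : ℝ≥0∞) * _ = _
    rw [exponent_eq, Real.exp_add, mul_assoc (n : ℝ), mul_left_comm (H : ℝ)]
    simp [q, ENNReal.ofReal_mul, Real.exp_nonneg]
  calc _ ≤ P ({ω | Z ∉ confSet F β (D ω) π} ∪ {ω | ∃ f ∈ confSet F β (D ω) π,
          ∃ h, ENNReal.ofReal (5 * β / (2 * N)) < ∫⁻ p, bellmanError M π f h p ∂(ν h)}) := by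
        refine measure_mono fun ω hω => or_iff_not_imp_left.2 fun hmem => ?_
        by_contra! hnear
        exact hω ⟨⟨Z, not_not.1 hmem, hZ⟩, by simpa using hnear⟩
    _ ≤ ENNReal.ofReal (H * ((n - 1) * q)) + ENNReal.ofReal (H * (n * q * q)) :=
        (measure_union_le _ _).trans (add_le_add reject_le accept_le)
    _ = ENNReal.ofReal (H * ((n - 1) * q) + H * (n * q * q)) := by
        have n_sub_one_nonneg : (0 : ℝ) ≤ n - 1 := sub_nonneg.2 (Nat.one_le_cast.2 n_pos)
        rw [ENNReal.ofReal_add (by positivity) (by positivity)]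
    _ ≤ _ := by
        refine ENNReal.ofReal_le_ofReal ?_
        have tail_le := mul_le_mul_of_nonneg_left hβ (by positivity : 0 ≤ H * q)
        linarith

lemma le_measure_forall_isSoundConfSet [NeZero H] [IsProbabilityMeasure P]
    [∀ h, IsProbabilityMeasure (ν h)] (hN : 0 < N) (hD : IsOfflineData P M ν Pi F D)
    (hF : BellmanComplete M Pi F) (hβ0 : 0 ≤ β) {δ : ℝ} (hδ : δ ≤ 1)
    (hβ : H * Pi.card * (Fintype.piFinset F).card * Real.exp (-β) ≤ δ) :
    ENNReal.ofReal (1 - δ)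
      ≤ P {ω | ∀ π ∈ Pi, IsSoundConfSet M ν F β (D ω) π (5 * β / (2 * N))} := by
  set n := (Fintype.piFinset F).card
  set q := Real.exp (-β)
  set good := {ω | ∀ π ∈ Pi, IsSoundConfSet M ν F β (D ω) π (5 * β / (2 * N))}
  have failure_le (π) (hπ : π ∈ Pi) :
      P {ω | ¬ IsSoundConfSet M ν F β (D ω) π (5 * β / (2 * N))}
        ≤ ENNReal.ofReal (H * n * q) := by
    refine hD.measure_not_isSoundConfSet_le hN hF hπ hβ0 (le_trans ?_ (hβ.trans hδ))
    have one_le_tests : (1 : ℝ) ≤ H * Pi.card := by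
      exact_mod_cast Nat.mul_pos (NeZero.pos H) (Finset.card_pos.2 ⟨π, hπ⟩)
    rw [mul_assoc]
    exact le_mul_of_one_le_left (by positivity) one_le_tests
  have bad_le : P goodᶜ ≤ ENNReal.ofReal δ :=
    calc P goodᶜ
        ≤ P (⋃ π ∈ Pi, {ω | ¬ IsSoundConfSet M ν F β (D ω) π (5 * β / (2 * N))}) :=
          measure_mono fun ω hω => by simpa [good] using hω
      _ ≤ ∑ _π ∈ Pi, ENNReal.ofReal (H * n * q) :=
          (measure_biUnion_finset_le _ _).trans (Finset.sum_le_sum failure_le)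
      _ = ENNReal.ofReal (H * Pi.card * n * q) := by
          rw [Finset.sum_const, nsmul_eq_mul, ← ENNReal.ofReal_natCast,
            ← ENNReal.ofReal_mul (by positivity)]
          ring_nf
      _ ≤ ENNReal.ofReal δ := ENNReal.ofReal_le_ofReal hβ
  rw [ENNReal.ofReal_sub _ (hβ.trans' (by positivity)), ENNReal.ofReal_one, tsub_le_iff_right]
  calc (1 : ℝ≥0∞) = P (good ∪ goodᶜ) := by rw [Set.union_compl_self, measure_univ]
    _ ≤ P good + ENNReal.ofReal δ := (measure_union_le _ _).trans (by gcongr)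

end IsOfflineData

end Data

section Algorithm

variable [NeZero H] {M : MDP H X A} {Pi : Finset (Policy H X A)}
  {F : Fin H → Finset (CondDist X A ρ)} {β : ℝ} {D : Dataset H N X A ρ}

lemma one_le_card_mul_card (hPi : Pi.Nonempty) (hF : BellmanComplete M Pi F) :
    (1 : ℝ) ≤ H * Pi.card * (Fintype.piFinset F).card := by
  obtain ⟨π, hπ⟩ := hPi
  obtain ⟨Z, hZF, -⟩ := exists_isBellmanFixed hF hπ
  exact_mod_cast Nat.mul_pos (Nat.mul_pos (NeZero.pos H) (Finset.card_pos.2 ⟨π, hπ⟩))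
    (Finset.card_pos.2 ⟨Z, hZF⟩)

lemma exists_isPDiscoOutput (hPi : Pi.Nonempty) (hne : ∀ π ∈ Pi, (confSet F β D π).Nonempty) :
    ∃ πhat, IsPDiscoOutput M Pi F β D πhat := by
  have : Nonempty (Fin H → CondDist X A ρ) := hPi.elim fun π hπ => (hne π hπ).nonempty
  have exists_max : ∀ π ∈ Pi, ∃ f ∈ confSet F β D π,
      ∀ f' ∈ confSet F β D π, estimate M π f' ≤ estimate M π f :=
    fun π hπ => Set.exists_max_image _ _
      ((Fintype.piFinset F).finite_toSet.subset fun _ hf => hf.1) (hne π hπ)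
  choose! sel hsel using exists_max
  obtain ⟨πhat, hπhat, hmin⟩ := Pi.exists_min_image (fun π => estimate M π (sel π)) hPi
  exact ⟨πhat, sel, hsel, hπhat, hmin⟩

lemma IsPDiscoOutput.value_sub_le {ν : Fin H → Measure (X × A)} [∀ h, SigmaFinite (ν h)] {ε : ℝ}
    (hε : 0 ≤ ε) (hsound : ∀ π ∈ Pi, IsSoundConfSet M ν F β D π ε) {πhat πt : Policy H X A}
    (hhat : IsPDiscoOutput M Pi F β D πhat) (hπt : πt ∈ Pi) (hC : concentrability M ν πt ≠ ∞) :
    value M πhat - value M πt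
      ≤ 4 * (√(returnVar M πt * (H ^ 2 * (concentrability M ν πt).toReal * ε))
        + H ^ 2 * (concentrability M ν πt).toReal * ε) := by
  obtain ⟨sel, hsel, hπhat, hmin⟩ := hhat
  obtain ⟨Zhat, hZhat, Zhat_fixed⟩ := (hsound πhat hπhat).1
  obtain ⟨⟨Z, -, Z_fixed⟩, error_le⟩ := hsound πt hπt
  calc value M πhat - value M πt
      = estimate M πhat Zhat - value M πt := by rw [estimate_eq_value Zhat_fixed]
    _ ≤ estimate M πt (sel πt) - value M πt :=
        sub_le_sub_right (((hsel πhat hπhat).2 Zhat hZhat).trans (hmin πt hπt)) _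
    _ ≤ _ := estimate_sub_value_le hC Z_fixed hε (error_le _ (hsel πt hπt).1)

end Algorithm

lemma log_div_nonneg {m δ : ℝ} (hm : 1 ≤ m) (hδ0 : 0 < δ) (hδ1 : δ ≤ 1) :
    0 ≤ Real.log (m / δ) :=
  Real.log_nonneg ((one_le_div hδ0).2 (hδ1.trans hm))

lemma mul_exp_neg_le {m δ β : ℝ} (hm : 0 < m) (hδ : 0 < δ) (hβ : Real.log (m / δ) ≤ β) :
    m * Real.exp (-β) ≤ δ := by
  rw [Real.exp_neg, ← div_eq_mul_inv, div_le_comm₀ (Real.exp_pos β) hδ]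
  exact (Real.log_le_iff_le_exp (by positivity)).1 hβ

lemma four_mul_sqrt_add_le {L : ℝ} (hL : 0 ≤ L) (V C β N : ℝ) :
    4 * (√(V * (L ^ 2 * C * (5 * β / (2 * N)))) + L ^ 2 * C * (5 * β / (2 * N)))
      ≤ 10 * (L * √(V * C * β / N) + L ^ 2 * C * β / N) := by
  have radicand_eq : V * (L ^ 2 * C * (5 * β / (2 * N))) = L ^ 2 * (5 / 2 * (V * C * β / N)) := by
    ring
  have sqrt_le : √(5 / 2) ≤ 5 / 2 := Real.sqrt_le_iff.2 ⟨by norm_num, by norm_num⟩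
  rw [radicand_eq, Real.sqrt_mul (sq_nonneg L), Real.sqrt_sq hL, Real.sqrt_mul (by norm_num)]
  calc _ ≤ 4 * (L * (5 / 2 * √(V * C * β / N)) + L ^ 2 * C * (5 * β / (2 * N))) := by gcongr
    _ = _ := by ring

lemma sq_le_rpow_five_halves [NeZero H] : (H : ℝ) ^ 2 ≤ (H : ℝ) ^ (5 / 2 : ℝ) := by
  rw [← Real.rpow_natCast]
  exact Real.rpow_le_rpow_of_exponent_le (Nat.one_le_cast.2 (NeZero.pos H)) (by norm_num)

end

end OfflineDistRL

open MeasureTheory ProbabilityTheory OfflineDistRL in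
theorem mainTheorem2_general {X A Ω : Type*} [MeasurableSpace X] [MeasurableSpace A]
    [MeasurableSpace Ω] {H N : ℕ} [NeZero H] (hN : 0 < N) {ρ : Measure ℝ} (M : MDP H X A)
    (ν : Fin H → Measure (X × A)) [∀ h, IsProbabilityMeasure (ν h)]
    {Pi : Finset (Policy H X A)} (hPi : Pi.Nonempty) {F : Fin H → Finset (CondDist X A ρ)}
    (hF : BellmanComplete M Pi F) (P : Measure Ω) [IsProbabilityMeasure P]
    {D : Ω → Dataset H N X A ρ} (hD : IsOfflineData P M ν Pi F D) {δ : ℝ} (hδ0 : 0 < δ)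
    (hδ1 : δ < 1) {β : ℝ}
    (hβ : Real.log (H * Pi.card * (Fintype.piFinset F).card / δ) ≤ β) :
    ENNReal.ofReal (1 - δ) ≤ P {ω |
      (∃ πhat, IsPDiscoOutput M Pi F β (D ω) πhat) ∧
      ∀ πhat, IsPDiscoOutput M Pi F β (D ω) πhat →
        ∀ πt ∈ Pi, concentrability M ν πt ≠ ⊤ →
          value M πhat - value M πt ≤
            10 * (H * √(returnVar M πt * (concentrability M ν πt).toReal * β / N)
              + (H : ℝ) ^ 2 * (concentrability M ν πt).toReal * β / N)} := by
  have one_le_tests := one_le_card_mul_card hPi hF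
  have β_nonneg : 0 ≤ β := (log_div_nonneg one_le_tests hδ0 hδ1.le).trans hβ
  have failure_le := mul_exp_neg_le (zero_lt_one.trans_le one_le_tests) hδ0 hβ
  refine (hD.le_measure_forall_isSoundConfSet hN hF β_nonneg hδ1.le failure_le).trans
    (measure_mono fun ω sound => ⟨?_, fun πhat hhat πt hπt hC => ?_⟩)
  · exact exists_isPDiscoOutput hPi fun π hπ => (sound π hπ).1.imp fun _ hZ => hZ.1
  · exact (hhat.value_sub_le (by positivity) sound hπt hC).trans
      (four_mul_sqrt_add_le (Nat.cast_nonneg H) _ _ _ _)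

open MeasureTheory ProbabilityTheory OfflineDistRL in
theorem mainTheorem2 :
    ∃ K : ℝ, 0 < K ∧
      ∀ {X A Ω : Type*} [MeasurableSpace X] [Fintype A] [MeasurableSpace A]
        [MeasurableSingletonClass A] [MeasurableSpace Ω]
        (H N : ℕ) [NeZero H] (_ : 0 < N) (ρ : Measure ℝ)
        (M : MDP H X A) (ν : Fin H → Measure (X × A)) (_ : ∀ h, IsProbabilityMeasure (ν h))
        (Pi : Finset (Policy H X A)) (_ : Pi.Nonempty)
        (F : Fin H → Finset (CondDist X A ρ)) (_ : BellmanComplete M Pi F)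
        (P : Measure Ω) (_ : IsProbabilityMeasure P)
        (D : Ω → Dataset H N X A ρ) (_ : IsOfflineData P M ν Pi F D)
        (δ : ℝ) (_ : 0 < δ) (_ : δ < 1) (β : ℝ)
        (_ : β = Real.log (H * Pi.card * (Fintype.piFinset F).card / δ)),
        ENNReal.ofReal (1 - δ) ≤ P {ω |
          (∃ πhat, IsPDiscoOutput M Pi F β (D ω) πhat) ∧
          ∀ πhat, IsPDiscoOutput M Pi F β (D ω) πhat →
            ∀ πt ∈ Pi, concentrability M ν πt ≠ ⊤ →
              value M πhat - value M πt ≤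
                K * (H * √(returnVar M πt * (concentrability M ν πt).toReal * β / N)
                  + (H : ℝ) ^ (5 / 2 : ℝ) * (concentrability M ν πt).toReal * β / N)} := by
  refine ⟨10, by norm_num, fun H N _ hN ρ M ν hν Pi hPi F hF P _ D hD δ hδ0 hδ1 β hβ => ?_⟩
  have β_nonneg : 0 ≤ β := hβ ▸ log_div_nonneg (one_le_card_mul_card hPi hF) hδ0 hδ1.le
  refine (mainTheorem2_general hN M ν hPi hF P hD hδ0 hδ1 hβ.ge).trans
    (measure_mono fun ω hω => ⟨hω.1, fun πhat hhat πt hπt hC => ?_⟩)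
  exact (hω.2 πhat hhat πt hπt hC).trans (by gcongr; exact sq_le_rpow_five_halves)
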